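/- Let $p,q,r,p',q',r'\ge 0$ be integers with $p+r=p'+r'$, $q+r=q'+r'$ and $p',q'\ge 1$, and let $\boldsymbol\alpha\in\mathbb C^p$, $\boldsymbol\beta\in\mathbb C^q$, $\boldsymbol\gamma\in\mathbb C^r$, $\boldsymbol\alpha'\in\mathbb C^{p'}$, $\boldsymbol\beta'\in\mathbb C^{q'}$, $\boldsymbol\gamma'\in\mathbb C^{r'}$, where no $1-\alpha'_i$, $1-\beta'_j$, $1-\gamma'_k$ is a non-positive integer. For $\boldsymbol a\in\mathbb C^N$ put $(\boldsymbol a)_m=\prod_{i=1}^N a_i(a_i+1)\cdots(a_i+m-1)$, and let $$F(x,y)=F^{p,q,r}_{p',q',r'}\Bigl(\begin{smallmatrix}\boldsymbol\alpha&\boldsymbol\beta&\boldsymbol\gamma\\ \boldsymbol\alpha'&\boldsymbol\beta'&\boldsymbol\gamma'\end{smallmatrix};x,y\Bigr)=\sum_{m=0}^\infty\sum_{n=0}^\infty\frac{(\boldsymbol\alpha)_m(\boldsymbol\beta)_n(\boldsymbol\gamma)_{m+n}}{(1-\boldsymbol\alpha')_m(1-\boldsymbol\beta')_n(1-\boldsymbol\gamma')_{m+n}}x^my^n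 .$$ For a function $u$ of $(x,y)$ define the integral transforms $$K_x^{\mu,\lambda}u(x,y)=\frac{\Gamma(\lambda+\mu)}{\Gamma(\mu)\Gamma(\lambda)}\int_0^1t^{\lambda-1}(1-t)^{\mu-1}u(tx,y)\,dt,$$ $K_y^{\mu,\lambda}$ and $\tilde K_{x,y}^{\mu,\lambda}$ by the same formula with $u(tx,y)$ replaced by $u(x,ty)$ and by $u(tx,ty)$ respectively, $$K_{x,y}^{\mu,(a,b)}u(x,y)=\frac{\Gamma(a+b+\mu)}{\Gamma(\mu)\Gamma(a)\Gamma(b)}\int_{t_1,t_2>0,\ t_1+t_2<1}t_1^{a-1}t_2^{b-1}(1-t_1-t_2)^{\mu-1}u(t_1x,t_2y)\,dt_1dt_2,$$ $$L_{x,y}^{\mu,(a,b)}u(x,y)=\frac{\Gamma(\mu+2)\Gamma(a)\Gamma(b)}{(2\pi i)^2\,\Gamma(a+b+\mu)}\int_{\frac13-i\infty}^{\frac13+i\infty}\!\int_{\frac13-i\infty}^{\frac13+i\infty}t_1^{1-a}t_2^{1-b}(1-t_1-t_2)^{-\mu-2}\,u\Bigl(\frac x{t_1},\frac y{t_2}\Bigr)\frac{dt_1}{t_1}\frac{dt_2}{t_2}.$$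 Here all powers are principal, and for each fixed $u$ and $(x,y)$ the transforms are extended by holomorphic continuation in the parameters: $K_x,K_y,\tilde K_{x,y}$ from $\operatorname{Re}\mu,\operatorname{Re}\lambda>0$ to $\lambda+\mu\notin\{0,-1,-2,\dots\}$; $K_{x,y}$ from $\operatorname{Re}\mu,\operatorname{Re}a,\operatorname{Re}b>0$ to $a+b+\mu\notin\{0,-1,-2,\dots\}$; and $L_{x,y}$ from $\operatorname{Re}\mu>-2$, $\operatorname{Re}a,\operatorname{Re}b>1$ to $a,b\notin\{0,-1,-2,\dots\}$. A product $\prod_{k=1}^NT_k$ of transforms means $T_1\circ\cdots\circ T_N$ (the identity if $N=0$). Assume $\alpha'_{p'}=\beta'_{q'}=0$. 1. If $r\le r'$, then for $|x|<1$ and $|y|<1$ the double series $F(x,y)$ converges absolutely and $$F(x,y)=\prod_{i=1}^{p'-1}K_x^{1-\alpha'_i-\alpha_i,\alpha_i}\prod_{j=1}^{q'-1}K_y^{1-\beta'_j-\beta_j,\beta_j}\prod_{k=1}^{r}\tilde K_{x,y}^{1-\gamma'_k-\gamma_k,\gamma_k}\prod_{k=1}^{r'-r}K_{x,y}^{1-\gamma'_{r+k}-\alpha_{p'+k-1}-\beta_{q'+k-1},(\alpha_{p'+k-1},\beta_{q'+k-1})}(1-x)^{-\alpha_p}(1-y)^{-\beta_q}.$$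 2. If $r>r'$, then for $3^{\,r-r'-1}(|x|+|y|)<1$ the double series $F(x,y)$ converges absolutely and $$F(x,y)=\prod_{i=1}^{p}K_x^{1-\alpha'_i-\alpha_i,\alpha_i}\prod_{j=1}^{q}K_y^{1-\beta'_j-\beta_j,\beta_j}\prod_{k=1}^{r'}\tilde K_{x,y}^{1-\gamma'_k-\gamma_k,\gamma_k}\prod_{k=1}^{r-r'-1}L_{x,y}^{\gamma_{r'+k}-(1-\alpha'_{p+k})-(1-\beta'_{q+k}),\,(1-\alpha'_{p+k},\,1-\beta'_{q+k})}(1-x-y)^{-\gamma_r}.$$ -/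

import Mathlib

open Complex

/-- The set of non-positive integers `{0, -1, -2, …}` in `ℂ`. -/
def nonposInts : Set ℂ := {z | ∃ n : ℕ, z = -(n : ℂ)}

/-- `(a)_m = (a_1)_m (a_2)_m ⋯ (a_N)_m` for a vector `(a_1, …, a_N)`. Vectors are indexed from `1`:
a vector with `N` entries is a sequence of which only the entries `1, …, N` are used. -/
noncomputable def vecPoch (N : ℕ) (a : ℕ → ℂ) (m : ℕ) : ℂ :=
  ∏ i ∈ Finset.Icc 1 N, (ascPochhammer ℂ m).eval (a i)

/-- The term of index `(m, n)` of the double hypergeometric series. -/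
noncomputable def hypTerm (p q r p' q' r' : ℕ) (α β γ α' β' γ' : ℕ → ℂ) (x y : ℂ) (m n : ℕ) : ℂ :=
  (vecPoch p α m * vecPoch q β n * vecPoch r γ (m + n)) /
    (vecPoch p' (fun i => 1 - α' i) m * vecPoch q' (fun j => 1 - β' j) n *
      vecPoch r' (fun k => 1 - γ' k) (m + n)) * x ^ m * y ^ n

/-- The hypergeometric series `F^{p,q,r}_{p',q',r'}(α β γ; α' β' γ'; x, y)`. -/
noncomputable def hypF (p q r p' q' r' : ℕ) (α β γ α' β' γ' : ℕ → ℂ) (x y : ℂ) : ℂ :=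
  ∑' m : ℕ, ∑' n : ℕ, hypTerm p q r p' q' r' α β γ α' β' γ' x y m n

open Classical in
/-- Holomorphic continuation of `f` from `V` to `Ω`: a function that is holomorphic on `Ω` and equal
to `f` on `V`, if there is one (and `f` itself otherwise). It is used for nonempty open `V ⊆ Ω`
with `Ω` open and connected (a complement of a locally finite family of complex hyperplanes),
so that its values on `Ω` are unique. -/
noncomputable def holoExt {E : Type*} [NormedAddCommGroup E] [NormedSpace ℂ E]
    (V Ω : Set E) (f : E → ℂ) : E → ℂ :=
  if h : ∃ g : E → ℂ, DifferentiableOn ℂ g Ω ∧ Set.EqOn g f V then h.choose else f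

/-- On `V` the continuation is the original function, whatever `Ω` is. -/
theorem holoExt_eq_of_mem {E : Type*} [NormedAddCommGroup E] [NormedSpace ℂ E]
    {V Ω : Set E} {f : E → ℂ} {P : E} (hP : P ∈ V) : holoExt V Ω f P = f P := by
  unfold holoExt
  split_ifs with h
  · exact h.choose_spec.2 hP
  · rfl

/-- The normalized Euler integral
`Γ(μ + ν) / (Γ(μ) Γ(ν)) ∫₀¹ t^(ν-1) (1-t)^(μ-1) φ(t) dt`, convergent for `Re μ, Re ν > 0`. -/
noncomputable def eulerInt (μ ν : ℂ) (φ : ℝ → ℂ) : ℂ :=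
  Gamma (ν + μ) / (Gamma μ * Gamma ν) *
    ∫ t in (0 : ℝ)..1, (t : ℂ) ^ (ν - 1) * (1 - (t : ℂ)) ^ (μ - 1) * φ t

/-- The normalized Euler integral, continued holomorphically in the parameters `(μ, ν)` from
`Re μ, Re ν > 0` to the set where `μ + ν` is not a non-positive integer. -/
noncomputable def eulerK (μ ν : ℂ) (φ : ℝ → ℂ) : ℂ :=
  holoExt {P : ℂ × ℂ | 0 < P.1.re ∧ 0 < P.2.re} {P : ℂ × ℂ | P.2 + P.1 ∉ nonposInts}
    (fun P => eulerInt P.1 P.2 φ) (μ, ν)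

/-- `K_x^{μ,ν}`. -/
noncomputable def opKx (μ ν : ℂ) (u : ℂ → ℂ → ℂ) : ℂ → ℂ → ℂ := fun x y =>
  eulerK μ ν (fun t => u (t * x) y)

/-- `K_y^{μ,ν}`. -/
noncomputable def opKy (μ ν : ℂ) (u : ℂ → ℂ → ℂ) : ℂ → ℂ → ℂ := fun x y =>
  eulerK μ ν (fun t => u x (t * y))

/-- `K̃_{x,y}^{μ,ν}`. -/
noncomputable def opKtilde (μ ν : ℂ) (u : ℂ → ℂ → ℂ) : ℂ → ℂ → ℂ := fun x y =>
  eulerK μ ν (fun t => u (t * x) (t * y))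

/-- The integral defining `K_{x,y}^{μ,(a,b)}`, convergent for `Re μ, Re a, Re b > 0`. -/
noncomputable def intKxy (μ a b : ℂ) (u : ℂ → ℂ → ℂ) (x y : ℂ) : ℂ :=
  Gamma (a + b + μ) / (Gamma μ * (Gamma a * Gamma b)) *
    ∫ t in {t : ℝ × ℝ | 0 < t.1 ∧ 0 < t.2 ∧ t.1 + t.2 < 1},
      (t.1 : ℂ) ^ (a - 1) * (t.2 : ℂ) ^ (b - 1) * (1 - (t.1 : ℂ) - (t.2 : ℂ)) ^ (μ - 1) *
        u (t.1 * x) (t.2 * y)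

/-- `K_{x,y}^{μ,(a,b)}`: the integral `intKxy`, continued holomorphically in `(μ, a, b)` to the set
where `a + b + μ` is not a non-positive integer. -/
noncomputable def opKxy (μ a b : ℂ) (u : ℂ → ℂ → ℂ) : ℂ → ℂ → ℂ := fun x y =>
  holoExt {P : ℂ × ℂ × ℂ | 0 < P.1.re ∧ 0 < P.2.1.re ∧ 0 < P.2.2.re}
    {P : ℂ × ℂ × ℂ | P.2.1 + P.2.2 + P.1 ∉ nonposInts}
    (fun P => intKxy P.1 P.2.1 P.2.2 u x y) (μ, a, b)

/-- The point `1/3 + i s` of the line of integration. -/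
noncomputable def lineThird (s : ℝ) : ℂ := 1 / 3 + s * I

/-- The integral defining `L_{x,y}^{μ,(a,b)}`, over `t₁, t₂ ∈ 1/3 + iℝ` with `dt_j = i ds_j`. For `u`
bounded along the contour it converges absolutely if `Re μ > -2` and `Re a, Re b > 1`. -/
noncomputable def intLxy (μ a b : ℂ) (u : ℂ → ℂ → ℂ) (x y : ℂ) : ℂ :=
  Gamma (μ + 2) * (Gamma a * Gamma b) / ((2 * Real.pi * I) ^ 2 * Gamma (a + b + μ)) *
    ∫ s₁ : ℝ, ∫ s₂ : ℝ,
      lineThird s₁ ^ (1 - a) * lineThird s₂ ^ (1 - b) *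
        (1 - lineThird s₁ - lineThird s₂) ^ (-μ - 2) *
        u (x / lineThird s₁) (y / lineThird s₂) *
        (I / lineThird s₁) * (I / lineThird s₂)

/-- `L_{x,y}^{μ,(a,b)}`: the integral `intLxy`, continued holomorphically in `(μ, a, b)` to the set
where neither `a` nor `b` is a non-positive integer. -/
noncomputable def opLxy (μ a b : ℂ) (u : ℂ → ℂ → ℂ) : ℂ → ℂ → ℂ := fun x y =>
  holoExt {P : ℂ × ℂ × ℂ | -2 < P.1.re ∧ 1 < P.2.1.re ∧ 1 < P.2.2.re}
    {P : ℂ × ℂ × ℂ | P.2.1 ∉ nonposInts ∧ P.2.2 ∉ nonposInts}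
    (fun P => intLxy P.1 P.2.1 P.2.2 u x y) (μ, a, b)

/-- The ordered product of operators `∏_{k=1}^N T_k = T_1 ∘ T_2 ∘ ⋯ ∘ T_N`. -/
def opProd (T : ℕ → (ℂ → ℂ → ℂ) → (ℂ → ℂ → ℂ)) : ℕ → (ℂ → ℂ → ℂ) → (ℂ → ℂ → ℂ)
  | 0 => id
  | N + 1 => opProd T N ∘ T (N + 1)

/-! Every transform acts diagonally on monomials. On `x ^ m * y ^ n` the Beta integral shows that
`K_x^{μ,λ}` multiplies by `(λ)_m / (λ+μ)_m`, and `K_y`, `K̃` do the same with `n` and `m + n` in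
place of `m`. Dirichlet's integral gives `(a)_m (b)_n / (a+b+μ)_{m+n}` for `K_{x,y}`, and Laplace
inversion gives the reverse shape `(a+b+μ)_{m+n} / ((a)_m (b)_n)` for `L_{x,y}`. The functions the
transforms start from have coefficients `(α_p)_m (β_q)_n / (m! n!)` and `(γ_r)_{m+n} / (m! n!)`.
Since `α'_{p'} = β'_{q'} = 0`, the factorials are the last factors `(1)_m`, `(1)_n` of the
denominator, and multiplying everything out gives the hypergeometric coefficient.

The analytic content is termwise application. Where the integrals converge, `hasSum_integral_weight`
interchanges sum and integral. For other parameters, the multipliers are holomorphic and grow,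
locally uniformly in the parameters, at most like `K ^ (m + n)` with any `K > 1` (like `3 ^ (m + n)`
for `L`). So the series of transformed terms is itself a holomorphic continuation, and uniqueness
along a complex line identifies it with the chosen one (`hasSum_holoExt`).

Domains are tracked by `HasDoubleSeries` on open sets stable under contraction of each coordinate.
The `K` transforms preserve such a set. `L` evaluates at `x / t` with `‖t‖ ≥ 1/3`, so each
application shrinks the `ℓ¹`-ball by a factor 3, whence the power of 3 in the second case. -/

section HypergeometricTransforms

open Filter Topology Set MeasureTheory
open scoped FourierTransform

/-! ### The exceptional parameter values. -/

/-- The non-positive integers are the zeros of the continuous function `1 / Γ`. -/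
theorem isClosed_nonposInts : IsClosed nonposInts := by
  have : nonposInts = {z : ℂ | (Gamma z)⁻¹ = 0} := by
    ext z
    simp [nonposInts, Gamma_eq_zero_iff]
  rw [this]
  exact isClosed_eq differentiable_one_div_Gamma.continuous continuous_const

theorem countable_nonposInts : nonposInts.Countable := by
  have : nonposInts = range fun n : ℕ => -(n : ℂ) := by
    ext z
    simp [nonposInts, eq_comm]
  rw [this]
  exact countable_range _

theorem notMem_nonposInts_of_re_pos {z : ℂ} (hz : 0 < z.re) : z ∉ nonposInts := by
  rintro ⟨n, rfl⟩
  simp at hz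
  linarith [n.cast_nonneg (α := ℝ)]

/-- On a complex line through a point of the right half-plane, an affine function that avoids the
non-positive integers at one more point meets them only countably often. -/
theorem countable_affine_mem_nonposInts {a b : ℂ} (ha : a ∉ nonposInts) :
    {z : ℂ | a + z * b ∈ nonposInts}.Countable := by
  rcases eq_or_ne b 0 with rfl | hb
  · simp [ha]
  · refine countable_nonposInts.preimage_of_injOn (f := fun z : ℂ => a + z * b) ?_
    intro z _ w _ h
    simpa [hb] using h

/-! ### Holomorphic continuation in the parameters. -/

section Continuation

variable {E : Type*} [NormedAddCommGroup E] [NormedSpace ℂ E]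

/-- Uniqueness of the holomorphic continuation along a complex line. -/
theorem eqOn_line_of_eqOn {V Ω : Set E} {f g : E → ℂ} (hV : IsOpen V) (hΩ : IsOpen Ω)
    (hf : DifferentiableOn ℂ f Ω) (hg : DifferentiableOn ℂ g Ω) (hfg : EqOn f g V)
    {P₀ P : E} (hP₀ : P₀ ∈ V) (hVΩ : V ⊆ Ω) (hP : P ∈ Ω)
    (hc : {z : ℂ | P₀ + z • (P - P₀) ∉ Ω}.Countable) : f P = g P := by
  set ℓ : ℂ → E := fun z => P₀ + z • (P - P₀) with hℓ
  have hℓd : Differentiable ℂ ℓ := by fun_prop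
  set U : Set ℂ := ℓ ⁻¹' Ω with hU
  have hUo : IsOpen U := hΩ.preimage hℓd.continuous
  -- The complement of a countable subset of the plane is connected; this is why the hypothesis on
  -- `Ω` is only a countability condition on one line.
  have hUc : IsPreconnected U := by
    have h := (hc.isPathConnected_compl_of_one_lt_rank (E := ℂ)
      (by rw [Complex.rank_real_complex]; norm_num)).isConnected.isPreconnected
    convert h using 1
    ext z
    simp [hU, hℓ]
  have hfa : AnalyticOnNhd ℂ (f ∘ ℓ) U :=
    (hf.comp hℓd.differentiableOn (mapsTo_preimage ℓ Ω)).analyticOnNhd hUo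
  have hga : AnalyticOnNhd ℂ (g ∘ ℓ) U :=
    (hg.comp hℓd.differentiableOn (mapsTo_preimage ℓ Ω)).analyticOnNhd hUo
  have h0 : ℓ 0 = P₀ := by simp [hℓ]
  have h1 : ℓ 1 = P := by simp [hℓ]
  have he : (f ∘ ℓ) =ᶠ[𝓝 0] (g ∘ ℓ) := by
    have : ℓ ⁻¹' V ∈ 𝓝 (0 : ℂ) :=
      hℓd.continuous.continuousAt.preimage_mem_nhds (hV.mem_nhds (by rwa [h0]))
    filter_upwards [this] with z hz using hfg hz
  have h := hfa.eqOn_of_preconnected_of_eventuallyEq hga hUc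
    (show (0 : ℂ) ∈ U by rw [hU, mem_preimage, h0]; exact hVΩ hP₀) he
    (show (1 : ℂ) ∈ U by rwa [hU, mem_preimage, h1])
  simpa [h1] using h

/-- `holoExt` is the continuation, wherever one is known. -/
theorem holoExt_eq_of_continuation {V Ω : Set E} {f g : E → ℂ} (hV : IsOpen V) (hΩ : IsOpen Ω)
    (hg : DifferentiableOn ℂ g Ω) (hgf : EqOn g f V)
    {P₀ P : E} (hP₀ : P₀ ∈ V) (hVΩ : V ⊆ Ω) (hP : P ∈ Ω)
    (hc : {z : ℂ | P₀ + z • (P - P₀) ∉ Ω}.Countable) : holoExt V Ω f P = g P := by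
  have h : ∃ g : E → ℂ, DifferentiableOn ℂ g Ω ∧ EqOn g f V := ⟨g, hg, hgf⟩
  rw [holoExt, dif_pos h]
  exact eqOn_line_of_eqOn hV hΩ h.choose_spec.1 hg (h.choose_spec.2.trans hgf.symm) hP₀ hVΩ hP hc

/-- Cauchy's estimate for the Fréchet derivative. -/
theorem norm_fderiv_le_of_forall_mem_ball {f : E → ℂ} {P : E} {r C : ℝ} (hr : 0 < r)
    (hf : DifferentiableOn ℂ f (Metric.ball P r)) (hC : ∀ Q ∈ Metric.ball P r, ‖f Q‖ ≤ C) :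
    ‖fderiv ℂ f P‖ ≤ 2 * C / r := by
  have hC0 : 0 ≤ C := (norm_nonneg _).trans (hC P (Metric.mem_ball_self hr))
  refine ContinuousLinearMap.opNorm_le_bound _ (by positivity) fun v => ?_
  rcases eq_or_ne v 0 with rfl | hv
  · simp
  have hv' : 0 < ‖v‖ := norm_pos_iff.mpr hv
  set ρ : ℝ := r / (2 * ‖v‖) with hρ
  have hρ0 : 0 < ρ := by positivity
  have hmem : ∀ z ∈ Metric.closedBall (0 : ℂ) ρ, P + z • v ∈ Metric.ball P r := by
    intro z hz
    rw [mem_closedBall_zero_iff] at hz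
    rw [mem_ball_iff_norm, add_sub_cancel_left, norm_smul]
    calc ‖z‖ * ‖v‖ ≤ ρ * ‖v‖ := by gcongr
      _ = r / 2 := by rw [hρ]; field_simp
      _ < r := by linarith
  have hd : DifferentiableOn ℂ (fun z : ℂ => f (P + z • v)) (Metric.closedBall 0 ρ) :=
    hf.comp (by fun_prop : Differentiable ℂ fun z : ℂ => P + z • v).differentiableOn hmem
  have hle := Complex.norm_deriv_le_of_forall_mem_sphere_norm_le hρ0
    (hd.diffContOnCl_ball Subset.rfl)
    (fun z hz => hC _ (hmem z (Metric.sphere_subset_closedBall hz)))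
  have hfd : HasFDerivAt f (fderiv ℂ f P) P :=
    ((hf P (Metric.mem_ball_self hr)).differentiableAt (Metric.ball_mem_nhds P hr)).hasFDerivAt
  have hline : HasDerivAt (fun z : ℂ => P + z • v) v 0 := by
    simpa using ((hasDerivAt_id (0 : ℂ)).smul_const v).const_add P
  have hder : HasDerivAt (fun z : ℂ => f (P + z • v)) (fderiv ℂ f P v) 0 := by
    have hfd' : HasFDerivAt f (fderiv ℂ f P) (P + (0 : ℂ) • v) := by simpa using hfd
    exact hfd'.comp_hasDerivAt (0 : ℂ) hline
  rw [hder.deriv] at hle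
  refine hle.trans (le_of_eq ?_)
  rw [hρ]
  field_simp

/-- A series of holomorphic functions that is normally convergent near each point is holomorphic. -/
theorem differentiableOn_tsum_of_locally_bounded {ι : Type*} {Ω : Set E} (hΩ : IsOpen Ω)
    {M : ι → E → ℂ} {b : ι → ℝ} (hb : Summable b) (hM : ∀ i, DifferentiableOn ℂ (M i) Ω)
    (hbd : ∀ P ∈ Ω, ∃ C : ℝ, ∀ᶠ Q in 𝓝 P, ∀ i, ‖M i Q‖ ≤ C * b i) :
    DifferentiableOn ℂ (fun P => ∑' i, M i P) Ω := by
  intro P hP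
  obtain ⟨C, hC⟩ := hbd P hP
  obtain ⟨ε, hε, hball⟩ := Metric.eventually_nhds_iff_ball.mp (hC.and (hΩ.mem_nhds hP))
  -- Halving the radius leaves a ball of radius `ε / 2` around each point, on which Cauchy's
  -- estimate turns the bound on the terms into a summable bound on their derivatives.
  have hsub : ∀ Q ∈ Metric.ball P (ε / 2), Metric.ball Q (ε / 2) ⊆ Metric.ball P ε := by
    intro Q hQ
    refine Metric.ball_subset_ball' ?_
    rw [Metric.mem_ball] at hQ
    linarith
  have hP' : P ∈ Metric.ball P (ε / 2) := Metric.mem_ball_self (by positivity)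
  let : NormedSpace ℝ E := NormedSpace.restrictScalars ℝ ℂ E
  have key := hasFDerivAt_tsum_of_isPreconnected (𝕜 := ℂ) (f := M)
    (f' := fun i Q => fderiv ℂ (M i) Q) (u := fun i => 2 * (C * b i) / (ε / 2))
    (s := Metric.ball P (ε / 2)) (x₀ := P) (x := P)
    (by simpa only [mul_div_assoc, mul_assoc] using
      (((hb.mul_left C).mul_left 2).div_const (ε / 2)))
    Metric.isOpen_ball (convex_ball P (ε / 2)).isPreconnected
    (fun i Q hQ => (((hM i) Q (hball Q (Metric.ball_subset_ball (by linarith) hQ)).2).differentiableAt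
      (hΩ.mem_nhds (hball Q (Metric.ball_subset_ball (by linarith) hQ)).2)).hasFDerivAt)
    (fun i Q hQ => norm_fderiv_le_of_forall_mem_ball (by positivity)
      ((hM i).mono fun S hS => (hball S (hsub Q hQ hS)).2)
      fun S hS => (hball S (hsub Q hQ hS)).1 i)
    hP' (Summable.of_norm_bounded (hb.mul_left C)
      (fun i => (hball P (Metric.mem_ball_self hε)).1 i)) hP'
  exact key.differentiableAt.differentiableWithinAt

/-- The continuation of a function that is given on `V` by a series of functions holomorphic on
`Ω`, locally uniformly dominated. -/
theorem hasSum_holoExt {ι : Type*} {V Ω : Set E} {f : E → ℂ} (hV : IsOpen V) (hΩ : IsOpen Ω)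
    {M : ι → E → ℂ} {e : ι → ℂ} {b : ι → ℝ} (hb : Summable fun i => ‖e i‖ * b i)
    (hM : ∀ i, DifferentiableOn ℂ (M i) Ω)
    (hbd : ∀ P ∈ Ω, ∃ C : ℝ, ∀ᶠ Q in 𝓝 P, ∀ i, ‖M i Q‖ ≤ C * b i)
    (hf : ∀ P ∈ V, HasSum (fun i => e i * M i P) (f P))
    {P₀ P : E} (hP₀ : P₀ ∈ V) (hVΩ : V ⊆ Ω) (hP : P ∈ Ω)
    (hc : {z : ℂ | P₀ + z • (P - P₀) ∉ Ω}.Countable) :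
    HasSum (fun i => e i * M i P) (holoExt V Ω f P) := by
  have hbd' : ∀ P ∈ Ω, ∃ C : ℝ, ∀ᶠ Q in 𝓝 P, ∀ i, ‖e i * M i Q‖ ≤ C * (‖e i‖ * b i) := by
    intro P hP
    obtain ⟨C, hC⟩ := hbd P hP
    refine ⟨C, hC.mono fun Q hQ i => ?_⟩
    rw [norm_mul, mul_left_comm]
    gcongr
    exact hQ i
  -- The sum of the series is a continuation, so one exists and the default branch of `holoExt` is
  -- not taken.
  have hd := differentiableOn_tsum_of_locally_bounded hΩ hb
    (fun i => (hM i).const_mul (e i)) hbd'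
  rw [holoExt_eq_of_continuation hV hΩ hd (fun Q hQ => (hf Q hQ).tsum_eq) hP₀ hVΩ hP hc]
  obtain ⟨C, hC⟩ := hbd' P hP
  exact (Summable.of_norm_bounded (hb.mul_left C) hC.self_of_nhds).hasSum

end Continuation

/-! ### Growth of rising factorials, locally uniform in the parameter. -/

section Pochhammer

/-- The value of the rising factorial `(a)_m`. -/
noncomputable abbrev poch (a : ℂ) (m : ℕ) : ℂ := (ascPochhammer ℂ m).eval a

theorem poch_succ (a : ℂ) (m : ℕ) : poch a (m + 1) = poch a m * (a + m) := by
  simp [poch, ascPochhammer_succ_right]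

theorem poch_eq_prod (a : ℂ) (m : ℕ) : poch a m = ∏ j ∈ Finset.range m, (a + j) := by
  induction m with
  | zero => simp [poch]
  | succ m ih => rw [poch_succ, ih, Finset.prod_range_succ]

theorem poch_ne_zero {a : ℂ} (ha : a ∉ nonposInts) (m : ℕ) : poch a m ≠ 0 := by
  rw [poch_eq_prod, Finset.prod_ne_zero_iff]
  intro j _ h
  exact ha ⟨j, eq_neg_of_add_eq_zero_left h⟩

theorem differentiable_poch (m : ℕ) : Differentiable ℂ fun a => poch a m :=
  (ascPochhammer ℂ m).differentiable

theorem Gamma_add_nat_eq_poch {a : ℂ} (ha : a ∉ nonposInts) (m : ℕ) :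
    Gamma (a + m) = poch a m * Gamma a := by
  have ha' : ∀ k : ℕ, a ≠ -k := fun k hk => ha ⟨k, hk⟩
  rw [poch, ← Gamma_add_nat_div_Gamma_eq a ha', div_mul_cancel₀ _ (Gamma_ne_zero ha')]

theorem factorial_eq_prod_range (m : ℕ) : (m.factorial : ℝ) = ∏ j ∈ Finset.range m, ((j : ℝ) + 1) := by
  rw [← Finset.prod_range_add_one_eq_factorial]
  push_cast
  rfl

/-- A product whose factors are eventually at most `R` grows at most like `R ^ m`. -/
theorem exists_prod_range_le_mul_pow {ρ : ℕ → ℝ} {R : ℝ} (hR : 0 < R) (hρ : ∀ j, 0 ≤ ρ j)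
    (h : ∀ᶠ j in atTop, ρ j ≤ R) :
    ∃ C : ℝ, 0 < C ∧ ∀ m, ∏ j ∈ Finset.range m, ρ j ≤ C * R ^ m := by
  obtain ⟨J, hJ⟩ := eventually_atTop.mp h
  -- Beyond `J` the factors `max (ρ j / R) 1` equal 1, so the product up to `J` bounds all of them.
  refine ⟨∏ j ∈ Finset.range J, max (ρ j / R) 1,
    Finset.prod_pos fun j _ => lt_max_of_lt_right one_pos, fun m => ?_⟩
  have h1 : ∏ j ∈ Finset.range m, max (ρ j / R) 1 ≤ ∏ j ∈ Finset.range J, max (ρ j / R) 1 := by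
    calc ∏ j ∈ Finset.range m, max (ρ j / R) 1
        ≤ ∏ j ∈ Finset.range (J + m), max (ρ j / R) 1 := by
          rw [add_comm J m, Finset.prod_range_add]
          refine le_mul_of_one_le_right
            (Finset.prod_nonneg fun j _ => le_max_of_le_right zero_le_one) ?_
          calc (1 : ℝ) = ∏ _j ∈ Finset.range J, 1 := by simp
            _ ≤ _ := Finset.prod_le_prod (fun _ _ => zero_le_one) fun j _ => le_max_right _ _
      _ = ∏ j ∈ Finset.range J, max (ρ j / R) 1 := by
          rw [Finset.prod_range_add]
          refine mul_eq_left₀ (Finset.prod_pos fun j _ => lt_max_of_lt_right one_pos).ne' |>.mpr ?_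
          refine Finset.prod_eq_one fun j _ => max_eq_right ?_
          rw [div_le_one hR]
          exact hJ _ (by omega)
  calc ∏ j ∈ Finset.range m, ρ j
      ≤ ∏ j ∈ Finset.range m, (max (ρ j / R) 1 * R) := by
        refine Finset.prod_le_prod (fun j _ => hρ j) fun j _ => ?_
        rw [← div_le_iff₀ hR]
        exact le_max_left _ _
    _ = (∏ j ∈ Finset.range m, max (ρ j / R) 1) * R ^ m := by
        rw [Finset.prod_mul_distrib]; simp
    _ ≤ _ := by gcongr

/-- Near `a₀` the ratio of consecutive factors `‖a + j‖ / (j + 1)` is at most `(A + j) / (j + 1)`,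
which tends to 1 and is therefore eventually below any `R > 1`. -/
theorem eventually_norm_poch_le (a₀ : ℂ) {R : ℝ} (hR : 1 < R) :
    ∃ C : ℝ, 0 < C ∧ ∀ᶠ a in 𝓝 a₀, ∀ m : ℕ, ‖poch a m‖ ≤ C * R ^ m * m.factorial := by
  set A : ℝ := ‖a₀‖ + 1
  obtain ⟨C, hC0, hC⟩ := exists_prod_range_le_mul_pow (ρ := fun j => (A + j) / (j + 1))
    (R := R) (by positivity) (fun j => by positivity) (by
      filter_upwards [tendsto_natCast_atTop_atTop.eventually_ge_atTop (A / (R - 1))] with j hj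
      have hR' : 0 < R - 1 := by linarith
      rw [div_le_iff₀ hR'] at hj
      rw [div_le_iff₀ (by positivity)]
      nlinarith)
  refine ⟨C, hC0, ?_⟩
  have hev : ∀ᶠ a : ℂ in 𝓝 a₀, ‖a‖ < A :=
    continuous_norm.continuousAt.eventually_lt continuousAt_const (by simp [A])
  filter_upwards [hev] with a ha m
  calc ‖poch a m‖ ≤ ∏ j ∈ Finset.range m, (A + j) := by
        rw [poch_eq_prod, norm_prod]
        refine Finset.prod_le_prod (fun _ _ => norm_nonneg _) fun j _ => ?_
        refine (norm_add_le _ _).trans ?_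
        simp only [norm_natCast]
        linarith
    _ = (∏ j ∈ Finset.range m, (A + j) / (j + 1)) * m.factorial := by
        rw [factorial_eq_prod_range, ← Finset.prod_mul_distrib]
        refine Finset.prod_congr rfl fun j _ => ?_
        field_simp
    _ ≤ _ := by gcongr; exact hC m

/-- The point `c₀` has positive distance `ε` from the closed set of poles, so on the ball of radius
`ε / 2` each `‖c + j‖` stays above `‖c₀ + j‖ - ε / 2 > 0`; the ratio of `j + 1` to this bound tends
to 1. -/
theorem eventually_factorial_le_norm_poch {c₀ : ℂ} (hc₀ : c₀ ∉ nonposInts) {R : ℝ} (hR : 1 < R) :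
    ∃ C : ℝ, 0 < C ∧ ∀ᶠ c in 𝓝 c₀, ∀ m : ℕ, (m.factorial : ℝ) ≤ C * R ^ m * ‖poch c m‖ := by
  obtain ⟨ε, hε, hball⟩ := Metric.isOpen_iff.mp isClosed_nonposInts.isOpen_compl c₀ hc₀
  have hdist : ∀ j : ℕ, ε ≤ ‖c₀ + j‖ := by
    intro j
    by_contra! h
    refine hball (a := -(j : ℂ)) ?_ ⟨j, rfl⟩
    rw [mem_ball_iff_norm, ← norm_neg]
    simpa [add_comm] using h
  have hpos : ∀ j : ℕ, 0 < ‖c₀ + j‖ - ε / 2 := fun j => by linarith [hdist j]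
  obtain ⟨C, hC0, hC⟩ := exists_prod_range_le_mul_pow (ρ := fun j => (j + 1) / (‖c₀ + j‖ - ε / 2))
    (R := R) (by positivity) (fun j => div_nonneg (by positivity) (hpos j).le) (by
      filter_upwards [tendsto_natCast_atTop_atTop.eventually_ge_atTop
        ((1 + R * (‖c₀‖ + ε / 2)) / (R - 1))] with j hj
      have hR' : 0 < R - 1 := by linarith
      rw [div_le_iff₀ hR'] at hj
      rw [div_le_iff₀ (hpos j)]
      have h1 : (j : ℝ) - ‖c₀‖ ≤ ‖c₀ + j‖ := by
        have := norm_sub_norm_le (j : ℂ) (-c₀)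
        simpa [add_comm] using this
      nlinarith)
  refine ⟨C, hC0, ?_⟩
  filter_upwards [Metric.ball_mem_nhds c₀ (half_pos hε)] with c hc m
  have hle : ∏ j ∈ Finset.range m, (‖c₀ + j‖ - ε / 2) ≤ ‖poch c m‖ := by
    rw [poch_eq_prod, norm_prod]
    refine Finset.prod_le_prod (fun j _ => (hpos j).le) fun j _ => ?_
    rw [mem_ball_iff_norm'] at hc
    have := norm_sub_norm_le (c₀ + j) (c + j)
    rw [add_sub_add_right_eq_sub] at this
    linarith
  calc (m.factorial : ℝ)
      = (∏ j ∈ Finset.range m, ((j : ℝ) + 1) / (‖c₀ + j‖ - ε / 2)) *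
          ∏ j ∈ Finset.range m, (‖c₀ + j‖ - ε / 2) := by
        rw [factorial_eq_prod_range, ← Finset.prod_mul_distrib]
        refine Finset.prod_congr rfl fun j _ => ?_
        rw [div_mul_cancel₀ _ (hpos j).ne']
    _ ≤ C * R ^ m * ∏ j ∈ Finset.range m, (‖c₀ + j‖ - ε / 2) := by
        gcongr
        · exact Finset.prod_nonneg fun j _ => (hpos j).le
        · exact hC m
    _ ≤ _ := by gcongr

end Pochhammer

/-! ### Growth of the multipliers of the transforms. -/

section Multipliers

variable {X : Type*} {l : Filter X} {a b c : X → ℂ} {a₀ b₀ c₀ : ℂ} {K : ℝ}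

/-- Numerator and denominator are both comparable to `m!`, each up to a factor `√K ^ m`. -/
theorem eventually_norm_poch_div_le (ha : Tendsto a l (𝓝 a₀)) (hc : Tendsto c l (𝓝 c₀))
    (hc₀ : c₀ ∉ nonposInts) (hK : 1 < K) :
    ∃ C : ℝ, ∀ᶠ z in l, ∀ m : ℕ, ‖poch (a z) m / poch (c z) m‖ ≤ C * K ^ m := by
  have hR : 1 < √K := by rwa [Real.lt_sqrt zero_le_one, one_pow]
  have hRR : √K * √K = K := Real.mul_self_sqrt (by linarith)
  obtain ⟨A, hA0, hA⟩ := eventually_norm_poch_le a₀ hR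
  obtain ⟨B, hB0, hB⟩ := eventually_factorial_le_norm_poch hc₀ hR
  refine ⟨A * B, ?_⟩
  filter_upwards [ha.eventually hA, hc.eventually hB] with z h1 h2 m
  have hc0 : 0 < ‖poch (c z) m‖ := by
    have := (show (0 : ℝ) < m.factorial by positivity).trans_le (h2 m)
    exact pos_of_mul_pos_right this (by positivity)
  rw [norm_div, div_le_iff₀ hc0]
  calc ‖poch (a z) m‖ ≤ A * √K ^ m * m.factorial := h1 m
    _ ≤ A * √K ^ m * (B * √K ^ m * ‖poch (c z) m‖) := by gcongr; exact h2 m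
    _ = A * B * (√K * √K) ^ m * ‖poch (c z) m‖ := by rw [mul_pow]; ring
    _ = _ := by rw [hRR]

/-- As for one variable; the factorials are now compared by `m! n! ≤ (m + n)!`. -/
theorem eventually_norm_poch_mul_div_le (ha : Tendsto a l (𝓝 a₀)) (hb : Tendsto b l (𝓝 b₀))
    (hc : Tendsto c l (𝓝 c₀)) (hc₀ : c₀ ∉ nonposInts) (hK : 1 < K) :
    ∃ C : ℝ, ∀ᶠ z in l, ∀ m n : ℕ,
      ‖poch (a z) m * poch (b z) n / poch (c z) (m + n)‖ ≤ C * K ^ (m + n) := by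
  have hR : 1 < √K := by rwa [Real.lt_sqrt zero_le_one, one_pow]
  have hRR : √K * √K = K := Real.mul_self_sqrt (by linarith)
  obtain ⟨A, hA0, hA⟩ := eventually_norm_poch_le a₀ hR
  obtain ⟨A', hA'0, hA'⟩ := eventually_norm_poch_le b₀ hR
  obtain ⟨B, hB0, hB⟩ := eventually_factorial_le_norm_poch hc₀ hR
  refine ⟨A * A' * B, ?_⟩
  filter_upwards [ha.eventually hA, hb.eventually hA', hc.eventually hB] with z h1 h1' h2 m n
  have hc0 : 0 < ‖poch (c z) (m + n)‖ := by
    have := (show (0 : ℝ) < (m + n).factorial by positivity).trans_le (h2 (m + n))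
    exact pos_of_mul_pos_right this (by positivity)
  have hf : (m.factorial * n.factorial : ℝ) ≤ (m + n).factorial := by
    exact_mod_cast Nat.le_of_dvd (Nat.factorial_pos _)
      (Nat.factorial_mul_factorial_dvd_factorial_add m n)
  rw [norm_div, norm_mul, div_le_iff₀ hc0]
  calc ‖poch (a z) m‖ * ‖poch (b z) n‖
      ≤ (A * √K ^ m * m.factorial) * (A' * √K ^ n * n.factorial) := by
        gcongr
        · exact h1 m
        · exact h1' n
    _ = A * A' * √K ^ (m + n) * (m.factorial * n.factorial) := by ring
    _ ≤ A * A' * √K ^ (m + n) * (B * √K ^ (m + n) * ‖poch (c z) (m + n)‖) :=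
        mul_le_mul_of_nonneg_left (hf.trans (h2 (m + n))) (by positivity)
    _ = A * A' * B * (√K * √K) ^ (m + n) * ‖poch (c z) (m + n)‖ := by rw [mul_pow]; ring
    _ = _ := by rw [hRR]

/-- Here the binomial coefficient `(m + n)! / (m! n!)` remains; bounding it by `2 ^ (m + n)` is the
source of the factor 2 in the rate. -/
theorem eventually_norm_poch_div_mul_le (ha : Tendsto a l (𝓝 a₀)) (hb : Tendsto b l (𝓝 b₀))
    (hc : Tendsto c l (𝓝 c₀)) (ha₀ : a₀ ∉ nonposInts) (hb₀ : b₀ ∉ nonposInts) (hK : 1 < K) :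
    ∃ C : ℝ, ∀ᶠ z in l, ∀ m n : ℕ,
      ‖poch (c z) (m + n) / (poch (a z) m * poch (b z) n)‖ ≤ C * (2 * K) ^ (m + n) := by
  have hR : 1 < √K := by rwa [Real.lt_sqrt zero_le_one, one_pow]
  have hRR : √K * √K = K := Real.mul_self_sqrt (by linarith)
  obtain ⟨A, hA0, hA⟩ := eventually_norm_poch_le c₀ hR
  obtain ⟨B, hB0, hB⟩ := eventually_factorial_le_norm_poch ha₀ hR
  obtain ⟨B', hB'0, hB'⟩ := eventually_factorial_le_norm_poch hb₀ hR
  refine ⟨A * B * B', ?_⟩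
  filter_upwards [hc.eventually hA, ha.eventually hB, hb.eventually hB'] with z h1 h2 h2' m n
  have ha0 : 0 < ‖poch (a z) m‖ := by
    have := (show (0 : ℝ) < m.factorial by positivity).trans_le (h2 m)
    exact pos_of_mul_pos_right this (by positivity)
  have hb0 : 0 < ‖poch (b z) n‖ := by
    have := (show (0 : ℝ) < n.factorial by positivity).trans_le (h2' n)
    exact pos_of_mul_pos_right this (by positivity)
  have hf : ((m + n).factorial : ℝ) ≤ 2 ^ (m + n) * (m.factorial * n.factorial) := by
    rw [← Nat.add_choose_mul_factorial_mul_factorial m n]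
    push_cast
    rw [mul_assoc]
    gcongr
    exact_mod_cast Nat.choose_le_two_pow (m + n) n
  rw [norm_div, norm_mul, div_le_iff₀ (by positivity)]
  calc ‖poch (c z) (m + n)‖ ≤ A * √K ^ (m + n) * (m + n).factorial := h1 _
    _ ≤ A * √K ^ (m + n) * (2 ^ (m + n) * ((B * √K ^ m * ‖poch (a z) m‖) *
          (B' * √K ^ n * ‖poch (b z) n‖))) := by
        gcongr
        refine hf.trans ?_
        gcongr
        · exact h2 m
        · exact h2' n
    _ = A * B * B' * (2 * (√K * √K)) ^ (m + n) * (‖poch (a z) m‖ * ‖poch (b z) n‖) := by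
        rw [mul_pow, mul_pow]; ring
    _ = _ := by rw [hRR]

end Multipliers

/-! ### Interchange of sum and integral. -/

section Interchange

theorem HasSum.of_forall_eq {ι : Type*} {f g : ι → ℂ} {s : ℂ} (h : HasSum f s)
    (hgf : ∀ i, g i = f i) : HasSum g s := by
  rwa [funext hgf]

variable {X ι : Type*} [MeasurableSpace X] {μ : Measure X} [Countable ι] {W : X → ℂ}
  {φ : ι → X → ℂ} {e : ι → ℂ} {u : X → ℂ}

/-- Termwise integration of a series of bounded functions against an integrable weight. -/
theorem hasSum_integral_weight (hW : Integrable W μ) (he : Summable fun i => ‖e i‖)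
    (hφ : ∀ i, AEStronglyMeasurable (φ i) μ) (hφ1 : ∀ i, ∀ᵐ x ∂μ, ‖φ i x‖ ≤ 1)
    (hu : ∀ᵐ x ∂μ, HasSum (fun i => e i * φ i x) (u x)) :
    HasSum (fun i => e i * ∫ x, W x * φ i x ∂μ) (∫ x, W x * u x ∂μ) := by
  have key := hasSum_integral_of_dominated_convergence (μ := μ)
    (F := fun i x => e i * (W x * φ i x)) (f := fun x => W x * u x)
    (fun i x => ‖W x‖ * ‖e i‖)
    (fun i => (hW.aestronglyMeasurable.mul (hφ i)).const_mul (e i))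
    (fun i => by
      filter_upwards [hφ1 i] with x hx
      rw [norm_mul, norm_mul]
      calc ‖e i‖ * (‖W x‖ * ‖φ i x‖) ≤ ‖e i‖ * (‖W x‖ * 1) := by gcongr
        _ = _ := by ring)
    (ae_of_all _ fun x => he.mul_left _)
    (by simpa only [tsum_mul_left] using hW.norm.mul_const _)
    (by
      filter_upwards [hu] with x hx
      simpa only [mul_left_comm] using hx.mul_left (W x))
  simpa only [integral_const_mul] using key

/-- This serves Fubini's theorem for the iterated integral in `intLxy`. Measurability of `u` is not
assumed: it follows from `u` being an almost everywhere limit of partial sums. -/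
theorem integrable_weight_mul_of_hasSum (hW : Integrable W μ) (he : Summable fun i => ‖e i‖)
    (hφ : ∀ i, AEStronglyMeasurable (φ i) μ) (hφ1 : ∀ i, ∀ᵐ x ∂μ, ‖φ i x‖ ≤ 1)
    (hu : ∀ᵐ x ∂μ, HasSum (fun i => e i * φ i x) (u x)) :
    Integrable (fun x => W x * u x) μ := by
  have hum : AEStronglyMeasurable u μ :=
    aestronglyMeasurable_of_tendsto_ae atTop
      (f := fun s : Finset ι => fun x => ∑ i ∈ s, e i * φ i x)
      (fun s => Finset.aestronglyMeasurable_fun_sum s fun i _ => (hφ i).const_mul (e i)) hu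
  refine hW.mul_bdd (c := ∑' i, ‖e i‖) hum ?_
  filter_upwards [hu, ae_all_iff.mpr hφ1] with x hx h1
  rw [← hx.tsum_eq]
  refine tsum_of_norm_bounded he.hasSum fun i => ?_
  rw [norm_mul]
  exact mul_le_of_le_one_right (norm_nonneg _) (h1 i)

end Interchange

/-! ### The one-variable Euler transforms. -/

section Euler

theorem ofReal_cpow_sub_one_mul_pow {t : ℝ} (ht : 0 < t) (ν : ℂ) (k : ℕ) :
    (t : ℂ) ^ (ν - 1) * (t : ℂ) ^ k = (t : ℂ) ^ (ν + k - 1) := by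
  rw [← cpow_natCast, ← cpow_add _ _ (ofReal_ne_zero.mpr ht.ne')]
  congr 1
  ring

/-- The factor `t ^ k` shifts `ν` to `ν + k` in the Beta integral, and the quotients of Gamma values
become rising factorials. -/
theorem eulerInt_pow {μ ν : ℂ} (hμ : 0 < μ.re) (hν : 0 < ν.re) (k : ℕ) :
    eulerInt μ ν (fun t => (t : ℂ) ^ k) = poch ν k / poch (ν + μ) k := by
  have hνμ : 0 < (ν + μ).re := by rw [add_re]; linarith
  have hνk : 0 < (ν + k).re := by
    rw [add_re, natCast_re]; positivity
  have h : ∫ t in (0 : ℝ)..1, (t : ℂ) ^ (ν - 1) * (1 - (t : ℂ)) ^ (μ - 1) * (t : ℂ) ^ k =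
      betaIntegral (ν + k) μ := by
    rw [betaIntegral, intervalIntegral.integral_of_le zero_le_one,
      intervalIntegral.integral_of_le zero_le_one]
    refine setIntegral_congr_fun measurableSet_Ioc fun t ht => ?_
    rw [mul_right_comm, ofReal_cpow_sub_one_mul_pow ht.1]
  rw [eulerInt, h, betaIntegral_eq_Gamma_mul_div _ _ hνk hμ,
    show ν + k + μ = ν + μ + k by ring, Gamma_add_nat_eq_poch (notMem_nonposInts_of_re_pos hν),
    Gamma_add_nat_eq_poch (notMem_nonposInts_of_re_pos hνμ)]
  have h1 := Gamma_ne_zero_of_re_pos hμ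
  have h2 := Gamma_ne_zero_of_re_pos hν
  have h3 := Gamma_ne_zero_of_re_pos hνμ
  have h4 := poch_ne_zero (notMem_nonposInts_of_re_pos hνμ) k
  field_simp

variable {ι : Type*} [Countable ι]

theorem hasSum_eulerInt {μ ν : ℂ} (hμ : 0 < μ.re) (hν : 0 < ν.re) {e : ι → ℂ} {k : ι → ℕ}
    {φ : ℝ → ℂ} (he : Summable fun i => ‖e i‖)
    (hφ : ∀ t : ℝ, 0 < t → t ≤ 1 → HasSum (fun i => e i * (t : ℂ) ^ k i) (φ t)) :
    HasSum (fun i => e i * (poch ν (k i) / poch (ν + μ) (k i))) (eulerInt μ ν φ) := by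
  have hW := betaIntegral_convergent hν hμ
  rw [intervalIntegrable_iff_integrableOn_Ioc_of_le zero_le_one] at hW
  have key := hasSum_integral_weight (φ := fun i (t : ℝ) => (t : ℂ) ^ k i) (u := φ) hW he
    (fun i => (continuous_ofReal.pow (k i)).aestronglyMeasurable)
    (fun i => by
      filter_upwards [ae_restrict_mem measurableSet_Ioc] with t ht
      rw [norm_pow, norm_real, Real.norm_of_nonneg ht.1.le]
      exact pow_le_one₀ ht.1.le ht.2)
    (by
      filter_upwards [ae_restrict_mem measurableSet_Ioc] with t ht using hφ t ht.1 ht.2)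
  have h2 := key.mul_left (Gamma (ν + μ) / (Gamma μ * Gamma ν))
  rw [eulerInt, intervalIntegral.integral_of_le zero_le_one]
  refine h2.of_forall_eq fun i => ?_
  rw [← eulerInt_pow hμ hν, eulerInt, intervalIntegral.integral_of_le zero_le_one]
  ring

theorem hasSum_eulerK {μ ν : ℂ} (h : ν + μ ∉ nonposInts) {e : ι → ℂ} {k : ι → ℕ}
    {φ : ℝ → ℂ} {K : ℝ} (hK : 1 < K) (he : Summable fun i => ‖e i‖ * K ^ k i)
    (hφ : ∀ t : ℝ, 0 < t → t ≤ 1 → HasSum (fun i => e i * (t : ℂ) ^ k i) (φ t)) :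
    HasSum (fun i => e i * (poch ν (k i) / poch (ν + μ) (k i))) (eulerK μ ν φ) := by
  have he' : Summable fun i => ‖e i‖ :=
    he.of_nonneg_of_le (fun _ => norm_nonneg _) fun i =>
      le_mul_of_one_le_right (norm_nonneg _) (one_le_pow₀ hK.le)
  unfold eulerK
  refine hasSum_holoExt (V := {P : ℂ × ℂ | 0 < P.1.re ∧ 0 < P.2.re})
    (Ω := {P : ℂ × ℂ | P.2 + P.1 ∉ nonposInts}) (f := fun P => eulerInt P.1 P.2 φ)
    (P := (μ, ν)) (P₀ := ((1 : ℂ), (1 : ℂ))) (b := fun i => K ^ k i) (e := e)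
    (M := fun i P => poch P.2 (k i) / poch (P.2 + P.1) (k i))
    ?_ ?_ he ?_ ?_ ?_ ?_ ?_ h ?_
  · exact (isOpen_lt continuous_const (continuous_re.comp continuous_fst)).inter
      (isOpen_lt continuous_const (continuous_re.comp continuous_snd))
  · exact isClosed_nonposInts.isOpen_compl.preimage (continuous_snd.add continuous_fst)
  · intro i P hP
    have h1 : Differentiable ℂ fun P : ℂ × ℂ => poch P.2 (k i) :=
      (differentiable_poch (k i)).comp differentiable_snd
    have h2 : Differentiable ℂ fun P : ℂ × ℂ => poch (P.2 + P.1) (k i) :=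
      (differentiable_poch (k i)).comp (differentiable_snd.add differentiable_fst)
    have h3 : poch (P.2 + P.1) (k i) ≠ 0 := poch_ne_zero hP _
    simp only [div_eq_mul_inv]
    exact ((h1 P).fun_mul ((h2 P).fun_inv h3)).differentiableWithinAt
  · intro P hP
    obtain ⟨C, hC⟩ := eventually_norm_poch_div_le (l := 𝓝 P) (a := Prod.snd)
      (c := fun P => P.2 + P.1) continuous_snd.continuousAt
      (continuous_snd.add continuous_fst).continuousAt hP hK
    exact ⟨C, hC.mono fun Q hQ i => hQ (k i)⟩
  · intro P hP
    exact hasSum_eulerInt hP.1 hP.2 he' hφ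
  · simp
  · intro P hP
    refine notMem_nonposInts_of_re_pos ?_
    rw [add_re]
    exact add_pos hP.2 hP.1
  -- On the line from the base point `(1, 1)`, the sum of the parameters is affine with value 2 at
  -- the start, so it meets the poles only countably often.
  · have h11 : (1 : ℂ) + 1 ∉ nonposInts := notMem_nonposInts_of_re_pos (by norm_num)
    refine (countable_affine_mem_nonposInts (b := ν - 1 + (μ - 1)) h11).mono fun z hz => ?_
    simp only [mem_ofPred_eq, not_not, Prod.snd_add, Prod.fst_add, Prod.smul_snd, Prod.smul_fst,
      Prod.snd_sub, Prod.fst_sub, smul_eq_mul] at hz ⊢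
    convert hz using 1
    ring

end Euler

/-! ### Dirichlet's integral and the transform `K_{x,y}`. -/

section Dirichlet

/-- The open standard triangle. -/
abbrev openTriangle : Set (ℝ × ℝ) := {t : ℝ × ℝ | 0 < t.1 ∧ 0 < t.2 ∧ t.1 + t.2 < 1}

theorem measurableSet_openTriangle : MeasurableSet openTriangle :=
  ((isOpen_lt continuous_const continuous_fst).inter
    ((isOpen_lt continuous_const continuous_snd).inter
      (isOpen_lt (continuous_fst.add continuous_snd) continuous_const))).measurableSet

/-- The integrand of Dirichlet's integral. -/
noncomputable def dirichletFun (A B M : ℂ) (t : ℝ × ℝ) : ℂ :=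
  (t.1 : ℂ) ^ (A - 1) * (t.2 : ℂ) ^ (B - 1) * (1 - (t.1 : ℂ) - (t.2 : ℂ)) ^ (M - 1)

theorem measurable_dirichletFun (A B M : ℂ) : Measurable (dirichletFun A B M) := by
  unfold dirichletFun
  fun_prop

/-- On the triangle all three bases are positive reals, so only the real parts of the exponents
affect the norm. In this form, integrability can be read off from the integral formulas themselves.
-/
theorem norm_dirichletFun (A B M : ℂ) {t : ℝ × ℝ} (ht : t ∈ openTriangle) :
    ((‖dirichletFun A B M t‖ : ℝ) : ℂ) = dirichletFun A.re B.re M.re t := by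
  have h3 : 0 < 1 - t.1 - t.2 := by linarith [ht.2.2]
  have hc : ∀ (s : ℝ) (z : ℂ), 0 < s → ((‖(s : ℂ) ^ (z - 1)‖ : ℝ) : ℂ) = (s : ℂ) ^ ((z.re : ℂ) - 1) := by
    intro s z hs
    rw [norm_cpow_eq_rpow_re_of_pos hs, ofReal_cpow hs.le]
    simp
  have h3' : (1 - (t.1 : ℂ) - (t.2 : ℂ)) = ((1 - t.1 - t.2 : ℝ) : ℂ) := by push_cast; rfl
  rw [dirichletFun, dirichletFun, h3', norm_mul, norm_mul, ofReal_mul, ofReal_mul, hc _ _ ht.1,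
    hc _ _ ht.2.1, hc _ _ h3]

theorem indicator_dirichletFun_section (A B M : ℂ) (s : ℝ) :
    (fun y => openTriangle.indicator (dirichletFun A B M) (s, y)) =
      (Ioo 0 1).indicator (fun x : ℝ => (Ioo 0 (1 - x)).indicator fun y : ℝ =>
        (x : ℂ) ^ (A - 1) * ((y : ℂ) ^ (B - 1) * (((1 - x : ℝ) : ℂ) - y) ^ (M - 1))) s := by
  funext y
  by_cases hs : s ∈ Ioo (0 : ℝ) 1
  · rw [indicator_of_mem hs]
    by_cases hy : y ∈ Ioo 0 (1 - s)
    · rw [indicator_of_mem hy, indicator_of_mem (show (s, y) ∈ openTriangle from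
        ⟨hs.1, hy.1, by linarith [hy.2]⟩), dirichletFun]
      push_cast
      ring
    · rw [indicator_of_notMem hy, indicator_of_notMem]
      exact fun h => hy ⟨h.2.1, by linarith [h.2.2]⟩
  · rw [indicator_of_notMem hs, indicator_of_notMem]
    · rfl
    · exact fun h => hs ⟨h.1, by linarith [h.2.1, h.2.2]⟩

theorem integral_dirichletFun_section (A B M : ℂ) (s : ℝ) :
    ∫ y, openTriangle.indicator (dirichletFun A B M) (s, y) =
      (Ioo 0 1).indicator (fun x : ℝ => (x : ℂ) ^ (A - 1) * (1 - (x : ℂ)) ^ (B + M - 1)) s *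
        betaIntegral B M := by
  rw [indicator_dirichletFun_section]
  by_cases hs : s ∈ Ioo (0 : ℝ) 1
  · rw [indicator_of_mem hs, indicator_of_mem hs, integral_indicator measurableSet_Ioo,
      integral_const_mul, ← integral_Ioc_eq_integral_Ioo,
      ← intervalIntegral.integral_of_le (by linarith [hs.2]),
      betaIntegral_scaled _ _ (by linarith [hs.2])]
    push_cast
    ring
  · rw [indicator_of_notMem hs, indicator_of_notMem hs]
    simp

theorem betaIntegral_ne_zero {u v : ℂ} (hu : 0 < u.re) (hv : 0 < v.re) : betaIntegral u v ≠ 0 := by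
  rw [betaIntegral_eq_Gamma_mul_div u v hu hv]
  exact div_ne_zero (mul_ne_zero (Gamma_ne_zero_of_re_pos hu) (Gamma_ne_zero_of_re_pos hv))
    (Gamma_ne_zero_of_re_pos (by rw [add_re]; linarith))

theorem measurable_indicator_dirichletFun (A B M : ℂ) :
    Measurable (openTriangle.indicator (dirichletFun A B M)) :=
  (measurable_dirichletFun A B M).indicator measurableSet_openTriangle

theorem norm_indicator_dirichletFun (A B M : ℂ) (t : ℝ × ℝ) :
    ((‖openTriangle.indicator (dirichletFun A B M) t‖ : ℝ) : ℂ) =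
      openTriangle.indicator (dirichletFun A.re B.re M.re) t := by
  by_cases ht : t ∈ openTriangle
  · rw [indicator_of_mem ht, indicator_of_mem ht, norm_dirichletFun A B M ht]
  · rw [indicator_of_notMem ht, indicator_of_notMem ht]
    simp

/-- A nonzero Bochner integral forces integrability. The section at the real parts of the parameters
has a nonzero Beta value as its integral, and it has the same norm as the given section. -/
theorem integrable_dirichletFun_section (A : ℂ) {B M : ℂ} (hB : 0 < B.re) (hM : 0 < M.re) (s : ℝ) :
    Integrable fun y => openTriangle.indicator (dirichletFun A B M) (s, y) := by
  by_cases hs : s ∈ Ioo (0 : ℝ) 1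
  · have hne : ∫ y, openTriangle.indicator (dirichletFun A.re B.re M.re) (s, y) ≠ 0 := by
      rw [integral_dirichletFun_section, indicator_of_mem hs]
      have h1 : (s : ℂ) ≠ 0 := ofReal_ne_zero.mpr hs.1.ne'
      have h2 : (1 - (s : ℂ)) ≠ 0 := by
        rw [← ofReal_one, ← ofReal_sub]
        exact ofReal_ne_zero.mpr (by linarith [hs.2])
      exact mul_ne_zero (mul_ne_zero (by simp [cpow_eq_zero_iff, h1]) (by simp [cpow_eq_zero_iff, h2]))
        (betaIntegral_ne_zero (by simpa using hB) (by simpa using hM))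
    have hi := Integrable.of_integral_ne_zero hne
    refine hi.mono ((measurable_indicator_dirichletFun A B M).comp
      measurable_prodMk_left).aestronglyMeasurable (ae_of_all _ fun y => ?_)
    rw [← norm_indicator_dirichletFun, norm_real, norm_norm]
  · rw [indicator_dirichletFun_section, indicator_of_notMem hs]
    exact integrable_zero _ _ _

theorem integrable_indicator_beta {A B : ℂ} (hA : 0 < A.re) (hB : 0 < B.re) :
    Integrable ((Ioo 0 1).indicator
      (fun x : ℝ => (x : ℂ) ^ (A - 1) * (1 - (x : ℂ)) ^ (B - 1))) := by
  have h := betaIntegral_convergent hA hB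
  rw [intervalIntegrable_iff_integrableOn_Ioo_of_le zero_le_one] at h
  exact h.integrable_indicator measurableSet_Ioo

theorem integrable_indicator_dirichletFun {A B M : ℂ} (hA : 0 < A.re) (hB : 0 < B.re)
    (hM : 0 < M.re) : Integrable (openTriangle.indicator (dirichletFun A B M)) := by
  rw [Measure.volume_eq_prod, integrable_prod_iff
    (measurable_indicator_dirichletFun A B M).aestronglyMeasurable]
  refine ⟨ae_of_all _ fun s => integrable_dirichletFun_section A hB hM s, ?_⟩
  -- The integrated norms are sections of Dirichlet's integrand at real parameters, hence a Beta
  -- integrand in the outer variable.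
  have h : ∀ s : ℝ, ∫ y, ‖openTriangle.indicator (dirichletFun A B M) (s, y)‖ =
      (∫ y, openTriangle.indicator (dirichletFun A.re B.re M.re) (s, y)).re := by
    intro s
    rw [← ofReal_re (∫ y, ‖openTriangle.indicator (dirichletFun A B M) (s, y)‖),
      ← integral_complex_ofReal]
    simp only [norm_indicator_dirichletFun]
  simp only [h, integral_dirichletFun_section]
  refine Integrable.re (𝕜 := ℂ) (Integrable.mul_const ?_ _)
  exact integrable_indicator_beta (by simpa using hA) (by simpa using add_pos hB hM)

/-- **Dirichlet's integral** over the triangle. -/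
theorem integral_dirichletFun {A B M : ℂ} (hA : 0 < A.re) (hB : 0 < B.re) (hM : 0 < M.re) :
    ∫ t in openTriangle, dirichletFun A B M t =
      Gamma A * Gamma B * Gamma M / Gamma (A + B + M) := by
  have hBM : 0 < (B + M).re := by rw [add_re]; linarith
  rw [← integral_indicator measurableSet_openTriangle, Measure.volume_eq_prod,
    integral_prod _ (integrable_indicator_dirichletFun hA hB hM)]
  simp only [integral_dirichletFun_section]
  rw [integral_mul_const, integral_indicator measurableSet_Ioo, ← integral_Ioc_eq_integral_Ioo,
    ← intervalIntegral.integral_of_le zero_le_one]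
  change betaIntegral A (B + M) * _ = _
  rw [betaIntegral_eq_Gamma_mul_div _ _ hA hBM, betaIntegral_eq_Gamma_mul_div _ _ hB hM, add_assoc]
  have := Gamma_ne_zero_of_re_pos hBM
  field_simp

theorem intKxy_eq (μ a b : ℂ) (u : ℂ → ℂ → ℂ) (x y : ℂ) :
    intKxy μ a b u x y = Gamma (a + b + μ) / (Gamma μ * (Gamma a * Gamma b)) *
      ∫ t in openTriangle, dirichletFun a b μ t * u (t.1 * x) (t.2 * y) := rfl

/-- The monomial shifts `a`, `b` by `m`, `n` in Dirichlet's integral. -/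
theorem integral_dirichletFun_mul_pow {a b μ : ℂ} (hμ : 0 < μ.re) (ha : 0 < a.re) (hb : 0 < b.re)
    (m n : ℕ) :
    Gamma (a + b + μ) / (Gamma μ * (Gamma a * Gamma b)) *
      ∫ t in openTriangle, dirichletFun a b μ t * ((t.1 : ℂ) ^ m * (t.2 : ℂ) ^ n) =
    poch a m * poch b n / poch (a + b + μ) (m + n) := by
  have hc : 0 < (a + b + μ).re := by simp only [add_re]; linarith
  have h : ∫ t in openTriangle, dirichletFun a b μ t * ((t.1 : ℂ) ^ m * (t.2 : ℂ) ^ n) =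
      ∫ t in openTriangle, dirichletFun (a + m) (b + n) μ t := by
    refine setIntegral_congr_fun measurableSet_openTriangle fun t ht => ?_
    simp only [dirichletFun]
    rw [← ofReal_cpow_sub_one_mul_pow ht.1, ← ofReal_cpow_sub_one_mul_pow ht.2.1]
    ring
  rw [h, integral_dirichletFun (by rw [add_re, natCast_re]; positivity)
    (by rw [add_re, natCast_re]; positivity) hμ,
    show a + m + (b + n) + μ = a + b + μ + ((m + n : ℕ) : ℂ) by push_cast; ring,
    Gamma_add_nat_eq_poch (notMem_nonposInts_of_re_pos ha),
    Gamma_add_nat_eq_poch (notMem_nonposInts_of_re_pos hb),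
    Gamma_add_nat_eq_poch (notMem_nonposInts_of_re_pos hc)]
  have h1 := Gamma_ne_zero_of_re_pos hμ
  have h2 := Gamma_ne_zero_of_re_pos ha
  have h3 := Gamma_ne_zero_of_re_pos hb
  have h4 := Gamma_ne_zero_of_re_pos hc
  have h5 := poch_ne_zero (notMem_nonposInts_of_re_pos hc) (m + n)
  field_simp

theorem hasSum_intKxy {a b μ : ℂ} (hμ : 0 < μ.re) (ha : 0 < a.re) (hb : 0 < b.re)
    {e : ℕ × ℕ → ℂ} {u : ℂ → ℂ → ℂ} {x y : ℂ} (he : Summable fun i => ‖e i‖)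
    (hu : ∀ t ∈ openTriangle,
      HasSum (fun i => e i * ((t.1 : ℂ) ^ i.1 * (t.2 : ℂ) ^ i.2)) (u (t.1 * x) (t.2 * y))) :
    HasSum (fun i => e i * (poch a i.1 * poch b i.2 / poch (a + b + μ) (i.1 + i.2)))
      (intKxy μ a b u x y) := by
  have hW : IntegrableOn (dirichletFun a b μ) openTriangle :=
    (integrable_indicator_iff measurableSet_openTriangle).mp
      (integrable_indicator_dirichletFun ha hb hμ)
  have key := hasSum_integral_weight
    (φ := fun (i : ℕ × ℕ) (t : ℝ × ℝ) => (t.1 : ℂ) ^ i.1 * (t.2 : ℂ) ^ i.2)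
    (u := fun t => u (t.1 * x) (t.2 * y)) hW he
    (fun i => (by fun_prop : Continuous fun t : ℝ × ℝ =>
      (t.1 : ℂ) ^ i.1 * (t.2 : ℂ) ^ i.2).aestronglyMeasurable)
    (fun i => by
      filter_upwards [ae_restrict_mem measurableSet_openTriangle] with t ht
      rw [norm_mul, norm_pow, norm_pow, norm_real, norm_real, Real.norm_of_nonneg ht.1.le,
        Real.norm_of_nonneg ht.2.1.le]
      exact mul_le_one₀ (pow_le_one₀ ht.1.le (by linarith [ht.2.1, ht.2.2]))
        (pow_nonneg ht.2.1.le _) (pow_le_one₀ ht.2.1.le (by linarith [ht.1, ht.2.2])))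
    (by
      filter_upwards [ae_restrict_mem measurableSet_openTriangle] with t ht using hu t ht)
  have h2 := key.mul_left (Gamma (a + b + μ) / (Gamma μ * (Gamma a * Gamma b)))
  rw [intKxy_eq]
  refine h2.of_forall_eq fun i => ?_
  rw [← integral_dirichletFun_mul_pow hμ ha hb]
  ring

theorem differentiable_poch_comp {E : Type*} [NormedAddCommGroup E] [NormedSpace ℂ E] {f : E → ℂ}
    (hf : Differentiable ℂ f) (m : ℕ) : Differentiable ℂ fun P => poch (f P) m :=
  (differentiable_poch m).comp hf

theorem hasSum_opKxy {a b μ : ℂ} (h : a + b + μ ∉ nonposInts) {e : ℕ × ℕ → ℂ} {u : ℂ → ℂ → ℂ}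
    {x y : ℂ} {K : ℝ} (hK : 1 < K) (he : Summable fun i => ‖e i‖ * K ^ (i.1 + i.2))
    (hu : ∀ t ∈ openTriangle,
      HasSum (fun i => e i * ((t.1 : ℂ) ^ i.1 * (t.2 : ℂ) ^ i.2)) (u (t.1 * x) (t.2 * y))) :
    HasSum (fun i => e i * (poch a i.1 * poch b i.2 / poch (a + b + μ) (i.1 + i.2)))
      (opKxy μ a b u x y) := by
  have he' : Summable fun i => ‖e i‖ :=
    he.of_nonneg_of_le (fun _ => norm_nonneg _) fun i =>
      le_mul_of_one_le_right (norm_nonneg _) (one_le_pow₀ hK.le)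
  have hcont : Differentiable ℂ fun P : ℂ × ℂ × ℂ => P.2.1 + P.2.2 + P.1 := by fun_prop
  unfold opKxy
  refine hasSum_holoExt (V := {P : ℂ × ℂ × ℂ | 0 < P.1.re ∧ 0 < P.2.1.re ∧ 0 < P.2.2.re})
    (Ω := {P : ℂ × ℂ × ℂ | P.2.1 + P.2.2 + P.1 ∉ nonposInts})
    (f := fun P => intKxy P.1 P.2.1 P.2.2 u x y)
    (P := (μ, a, b)) (P₀ := ((1 : ℂ), (1 : ℂ), (1 : ℂ))) (b := fun i => K ^ (i.1 + i.2)) (e := e)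
    (M := fun i P => poch P.2.1 i.1 * poch P.2.2 i.2 / poch (P.2.1 + P.2.2 + P.1) (i.1 + i.2))
    ?_ ?_ he ?_ ?_ ?_ ?_ ?_ h ?_
  · exact (isOpen_lt continuous_const (continuous_re.comp continuous_fst)).inter
      ((isOpen_lt continuous_const (continuous_re.comp (continuous_fst.comp continuous_snd))).inter
        (isOpen_lt continuous_const (continuous_re.comp (continuous_snd.comp continuous_snd))))
  · exact isClosed_nonposInts.isOpen_compl.preimage hcont.continuous
  · intro i P hP
    have h1 := differentiable_poch_comp (f := fun P : ℂ × ℂ × ℂ => P.2.1) (by fun_prop) i.1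
    have h2 := differentiable_poch_comp (f := fun P : ℂ × ℂ × ℂ => P.2.2) (by fun_prop) i.2
    have h3 := differentiable_poch_comp hcont (i.1 + i.2)
    have h4 : poch (P.2.1 + P.2.2 + P.1) (i.1 + i.2) ≠ 0 := poch_ne_zero hP _
    simp only [div_eq_mul_inv]
    exact (((h1.fun_mul h2) P).fun_mul ((h3 P).fun_inv h4)).differentiableWithinAt
  · intro P hP
    obtain ⟨C, hC⟩ := eventually_norm_poch_mul_div_le (l := 𝓝 P) (a := fun P => P.2.1)
      (b := fun P => P.2.2) (c := fun P => P.2.1 + P.2.2 + P.1)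
      (Continuous.tendsto (by fun_prop) P) (Continuous.tendsto (by fun_prop) P)
      hcont.continuous.continuousAt hP hK
    exact ⟨C, hC.mono fun Q hQ i => hQ i.1 i.2⟩
  · intro P hP
    exact hasSum_intKxy hP.1 hP.2.1 hP.2.2 he' hu
  · simp
  · intro P hP
    refine notMem_nonposInts_of_re_pos ?_
    simp only [add_re]
    linarith [hP.1, hP.2.1, hP.2.2]
  · have h11 : (1 : ℂ) + 1 + 1 ∉ nonposInts := notMem_nonposInts_of_re_pos (by norm_num)
    refine (countable_affine_mem_nonposInts (b := a - 1 + (b - 1) + (μ - 1)) h11).mono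
      fun z hz => ?_
    simp only [mem_ofPred_eq, not_not, Prod.snd_add, Prod.fst_add, Prod.smul_snd, Prod.smul_fst,
      Prod.snd_sub, Prod.fst_sub, smul_eq_mul] at hz ⊢
    convert hz using 1
    ring

end Dirichlet

/-! ### Laplace transform of a complex power. -/

section Laplace

theorem norm_ofReal_cpow_mul_exp {t : ℝ} (ht : 0 < t) (a r : ℂ) :
    ‖(t : ℂ) ^ (a - 1) * exp (-(r * t))‖ = t ^ (a.re - 1) * Real.exp (-r.re * t) := by
  rw [norm_mul, norm_cpow_eq_rpow_re_of_pos ht, norm_exp]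
  simp

theorem measurable_ofReal_cpow_mul_exp (a r : ℂ) :
    Measurable fun t : ℝ => (t : ℂ) ^ (a - 1) * exp (-(r * t)) := by
  fun_prop

theorem integrableOn_rpow_mul_exp_neg_mul {s b : ℝ} (hs : -1 < s) (hb : 0 < b) :
    IntegrableOn (fun t : ℝ => t ^ s * Real.exp (-b * t)) (Ioi 0) := by
  simpa using integrableOn_rpow_mul_exp_neg_mul_rpow hs one_pos hb

theorem integrableOn_cpow_mul_exp_neg_mul {a r : ℂ} (ha : 0 < a.re) (hr : 0 < r.re) :
    IntegrableOn (fun t : ℝ => (t : ℂ) ^ (a - 1) * exp (-(r * t))) (Ioi 0) := by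
  refine (integrableOn_rpow_mul_exp_neg_mul (s := a.re - 1) (by linarith) hr).mono'
    (measurable_ofReal_cpow_mul_exp a r).aestronglyMeasurable ?_
  filter_upwards [ae_restrict_mem measurableSet_Ioi] with t ht
  rw [norm_ofReal_cpow_mul_exp ht]

theorem differentiableOn_integral_cpow_mul_exp {a : ℂ} (ha : 0 < a.re) :
    DifferentiableOn ℂ (fun r => ∫ t in Ioi (0 : ℝ), (t : ℂ) ^ (a - 1) * exp (-(r * t)))
      {r | 0 < r.re} := by
  intro r₀ hr₀
  have hr₀' : 0 < r₀.re := hr₀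
  have hs : {r : ℂ | r₀.re / 2 < r.re} ∈ 𝓝 r₀ :=
    (isOpen_lt continuous_const continuous_re).mem_nhds (by
      change r₀.re / 2 < r₀.re
      linarith)
  have key := hasDerivAt_integral_of_dominated_loc_of_deriv_le (μ := volume.restrict (Ioi (0 : ℝ)))
    (F := fun r t => (t : ℂ) ^ (a - 1) * exp (-(r * t)))
    (F' := fun r t => (t : ℂ) ^ (a - 1) * (exp (-(r * t)) * (-t)))
    (bound := fun t => t ^ a.re * Real.exp (-(r₀.re / 2) * t)) hs
    (.of_forall fun r => (measurable_ofReal_cpow_mul_exp a r).aestronglyMeasurable)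
    (integrableOn_cpow_mul_exp_neg_mul ha hr₀)
    (by fun_prop)
    (by
      filter_upwards [ae_restrict_mem measurableSet_Ioi] with t ht r hr
      have ht' : 0 < t := ht
      rw [← mul_assoc, norm_mul, norm_ofReal_cpow_mul_exp ht, norm_neg, norm_real,
        Real.norm_of_nonneg ht'.le]
      calc t ^ (a.re - 1) * Real.exp (-r.re * t) * t
          = (t ^ (a.re - 1) * t) * Real.exp (-r.re * t) := by ring
        _ = t ^ a.re * Real.exp (-r.re * t) := by
            rw [← Real.rpow_add_one ht'.ne', sub_add_cancel]
        _ ≤ _ := by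
            have : r₀.re / 2 < r.re := hr
            gcongr)
    (integrableOn_rpow_mul_exp_neg_mul (by linarith) (by linarith))
    (by
      filter_upwards with t r _
      refine HasDerivAt.const_mul _ ?_
      have h : HasDerivAt (fun r : ℂ => -(r * t)) (-(t : ℂ)) r := by
        simpa using ((hasDerivAt_id r).mul_const (t : ℂ)).fun_neg
      exact h.cexp)
  exact key.2.differentiableAt.differentiableWithinAt

theorem mem_slitPlane_of_re_pos {z : ℂ} (hz : 0 < z.re) : z ∈ slitPlane := Or.inl hz

/-- The Laplace transform of a complex power, at a complex point of the right half-plane. -/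
theorem integral_cpow_mul_exp_neg_mul_Ioi_of_re_pos {a r : ℂ} (ha : 0 < a.re) (hr : 0 < r.re) :
    ∫ t in Ioi (0 : ℝ), (t : ℂ) ^ (a - 1) * exp (-(r * t)) = r ^ (-a) * Gamma a := by
  have hopen : IsOpen {r : ℂ | 0 < r.re} := isOpen_lt continuous_const continuous_re
  have hconn : IsPreconnected {r : ℂ | 0 < r.re} := (convex_halfSpace_re_gt 0).isPreconnected
  have h1 := (differentiableOn_integral_cpow_mul_exp ha).analyticOnNhd hopen
  have h2 : AnalyticOnNhd ℂ (fun r : ℂ => r ^ (-a) * Gamma a) {r : ℂ | 0 < r.re} := by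
    refine DifferentiableOn.analyticOnNhd (fun r hr => ?_) hopen
    exact ((differentiableAt_id.cpow_const
      (mem_slitPlane_of_re_pos hr)).mul_const _).differentiableWithinAt
  -- Both sides are holomorphic on the right half-plane and agree on the positive reals, which
  -- accumulate at 1.
  refine h1.eqOn_of_preconnected_of_frequently_eq h2 hconn (z₀ := 1) (by simp) ?_ hr
  have hreal : ∀ x : ℝ, 0 < x → ∫ t in Ioi (0 : ℝ), (t : ℂ) ^ (a - 1) * exp (-((x : ℂ) * t)) =
      (x : ℂ) ^ (-a) * Gamma a := by
    intro x hx
    rw [integral_cpow_mul_exp_neg_mul_Ioi ha hx, one_div, inv_cpow, cpow_neg]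
    rw [arg_ofReal_of_nonneg hx.le]
    exact Real.pi_pos.ne
  have htend : Tendsto (fun x : ℝ => (x : ℂ)) (𝓝[≠] 1) (𝓝[≠] 1) := by
    refine tendsto_nhdsWithin_iff.mpr ⟨?_, ?_⟩
    · exact (continuous_ofReal.tendsto' 1 1 (by simp)).mono_left nhdsWithin_le_nhds
    · filter_upwards [self_mem_nhdsWithin] with x hx
      simpa using hx
  refine htend.frequently (Eventually.frequently ?_)
  have : ∀ᶠ x : ℝ in 𝓝[≠] 1, 0 < x := nhdsWithin_le_nhds (lt_mem_nhds one_pos)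
  filter_upwards [this] with x hx using hreal x hx

end Laplace

/-! ### Laplace inversion along a vertical line. -/

section LineIntegral

theorem norm_cpow_le_mul_exp (z w : ℂ) :
    ‖z ^ w‖ ≤ ‖z‖ ^ w.re * Real.exp (Real.pi * |w.im|) := by
  refine (norm_cpow_le z w).trans ?_
  rw [div_eq_mul_inv, ← Real.exp_neg]
  gcongr
  calc -(arg z * w.im) ≤ |arg z * w.im| := neg_le_abs _
    _ = |arg z| * |w.im| := abs_mul _ _
    _ ≤ _ := by gcongr; exact abs_arg_le_pi z

theorem measurable_vertical_cpow (c : ℝ) (A : ℂ) :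
    Measurable fun s : ℝ => ((c : ℂ) + s * I) ^ A := by
  fun_prop

/-- The function `(c + i s)^(-A)` is integrable over the line if `Re A > 1`. -/
theorem integrable_vertical_cpow {c : ℝ} (hc : 0 < c) {A : ℂ} (hA : 1 < A.re) :
    Integrable fun s : ℝ => ((c : ℂ) + s * I) ^ (-A) := by
  set κ : ℝ := min c 1 / 2 with hκ
  have hκ0 : 0 < κ := by positivity
  have hle : ∀ s : ℝ, κ * (1 + ‖s‖) ≤ ‖(c : ℂ) + s * I‖ := by
    intro s
    have h1 : c ≤ ‖(c : ℂ) + s * I‖ := by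
      have := re_le_norm ((c : ℂ) + s * I)
      simpa using this
    have h2 : |s| ≤ ‖(c : ℂ) + s * I‖ := by
      have := abs_im_le_norm ((c : ℂ) + s * I)
      simpa using this
    have h3 : min c 1 ≤ c := min_le_left _ _
    have h4 : min c 1 ≤ 1 := min_le_right _ _
    rw [Real.norm_eq_abs]
    nlinarith [abs_nonneg s]
  have hi : Integrable fun s : ℝ => (1 + ‖s‖) ^ (-A.re) := integrable_one_add_norm (by simpa using hA)
  refine (hi.const_mul (κ ^ (-A.re) * Real.exp (Real.pi * |(-A).im|))).mono'
    (measurable_vertical_cpow c _).aestronglyMeasurable (ae_of_all _ fun s => ?_)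
  refine (norm_cpow_le_mul_exp _ _).trans ?_
  have h := Real.rpow_le_rpow_of_nonpos (z := -A.re) (by positivity) (hle s) (by linarith)
  rw [Real.mul_rpow hκ0.le (by positivity)] at h
  rw [neg_re]
  calc _ ≤ κ ^ (-A.re) * (1 + ‖s‖) ^ (-A.re) * Real.exp (Real.pi * |(-A).im|) := by gcongr
    _ = _ := by ring

/-- Inversion of the Laplace transform of a power: the inverse transform of `(c + i s)^(-A)`. -/
theorem integral_vertical_cpow_mul_exp {c : ℝ} (hc : 0 < c) {A : ℂ} (hA : 1 < A.re) {σ : ℝ}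
    (hσ : 0 < σ) :
    ∫ s : ℝ, ((c : ℂ) + s * I) ^ (-A) * exp (s * I * σ) =
      2 * Real.pi / Gamma A * ((σ : ℂ) ^ (A - 1) * exp (-(c * σ))) := by
  have hA0 : 0 < A.re := by linarith
  -- The Fourier transform of `f` is `Γ(A) (c + 2πiξ)^(-A)`. It is integrable because `Re A > 1`,
  -- and `f` is continuous at `σ > 0`, so pointwise Fourier inversion applies; the scaling `s = 2πξ`
  -- yields the claim.
  set f : ℝ → ℂ := (Ioi 0).indicator fun t : ℝ => (t : ℂ) ^ (A - 1) * exp (-((c : ℂ) * t)) with hf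
  have hfi : Integrable f :=
    (integrableOn_cpow_mul_exp_neg_mul hA0 (by simpa using hc)).integrable_indicator
      measurableSet_Ioi
  have hF : 𝓕 f = fun ξ : ℝ => Gamma A * ((c : ℂ) + (2 * Real.pi * ξ : ℝ) * I) ^ (-A) := by
    funext ξ
    have hre : 0 < ((c : ℂ) + (2 * Real.pi * ξ : ℝ) * I).re := by simpa using hc
    rw [Real.fourier_eq', mul_comm (Gamma A), ← integral_cpow_mul_exp_neg_mul_Ioi_of_re_pos hA0 hre,
      ← integral_indicator measurableSet_Ioi]
    refine integral_congr_ae (ae_of_all _ fun t => ?_)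
    simp only [hf, smul_eq_mul]
    by_cases ht : t ∈ Ioi (0 : ℝ)
    · rw [indicator_of_mem ht, indicator_of_mem ht, mul_left_comm, ← Complex.exp_add]
      congr 2
      simp
      ring
    · rw [indicator_of_notMem ht, indicator_of_notMem ht, mul_zero]
  have hFi : Integrable (𝓕 f) := by
    rw [hF]
    exact ((integrable_vertical_cpow hc hA).comp_mul_left'
      (by positivity : 2 * Real.pi ≠ 0)).const_mul _
  have hcont : ContinuousAt f σ := by
    have h1 : ContinuousAt (fun t : ℝ => (t : ℂ) ^ (A - 1) * exp (-((c : ℂ) * t))) σ := by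
      refine ContinuousAt.mul ?_ (by fun_prop)
      exact (continuousAt_ofReal_cpow_const σ (A - 1) (Or.inr hσ.ne'))
    refine h1.congr ?_
    filter_upwards [Ioi_mem_nhds hσ] with t ht
    rw [hf, indicator_of_mem ht]
  have hinv := hfi.fourierInv_fourier_eq hFi hcont
  rw [Real.fourierInv_eq', hF] at hinv
  have hsub := Measure.integral_comp_mul_left
    (fun s : ℝ => ((c : ℂ) + s * I) ^ (-A) * exp (s * I * σ)) (2 * Real.pi)
  have hG : Gamma A ≠ 0 := Gamma_ne_zero_of_re_pos hA0
  have hpi : (Real.pi : ℂ) ≠ 0 := ofReal_ne_zero.mpr Real.pi_ne_zero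
  have hL : Gamma A * ∫ ξ : ℝ, ((c : ℂ) + (2 * Real.pi * ξ : ℝ) * I) ^ (-A) *
      exp ((2 * Real.pi * ξ : ℝ) * I * σ) = f σ := by
    rw [← hinv, ← integral_const_mul]
    refine integral_congr_ae (ae_of_all _ fun ξ => ?_)
    simp only [smul_eq_mul]
    have hexp : (2 * Real.pi * inner ℝ ξ σ : ℝ) * I = (2 * Real.pi * ξ : ℝ) * I * σ := by
      simp
      ring
    rw [hexp]
    ring
  rw [hsub, hf, indicator_of_mem (show σ ∈ Ioi (0 : ℝ) from hσ), abs_of_pos (by positivity),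
    real_smul] at hL
  rw [← hL]
  generalize ∫ s : ℝ, ((c : ℂ) + s * I) ^ (-A) * exp (s * I * σ) = J
  push_cast
  field_simp

/-- The convolution of two powers along a vertical line. -/
theorem integral_vertical_cpow_mul_cpow {c : ℝ} (hc : 0 < c) {A B w : ℂ} (hA : 1 < A.re)
    (hB : 0 < B.re) (hw : c < w.re) :
    ∫ s : ℝ, ((c : ℂ) + s * I) ^ (-A) * (w - (c + s * I)) ^ (-B) =
      2 * Real.pi * Gamma (A + B - 1) / (Gamma A * Gamma B) * w ^ (-(A + B - 1)) := by
  have hGA : Gamma A ≠ 0 := Gamma_ne_zero_of_re_pos (by linarith)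
  have hGB : Gamma B ≠ 0 := Gamma_ne_zero_of_re_pos hB
  have hwc : 0 < (w - c).re := by simpa using hw
  -- Multiplied by `Γ(B)`, the second power is the Laplace transform of `t ^ (B - 1)`. After Fubini
  -- the `s`-integral is an inverse transform, and what remains is a Laplace integral at `w` with
  -- exponent `A + B - 1`.
  set h : ℝ → ℂ := fun t => (t : ℂ) ^ (B - 1) * exp (-((w - c) * t)) with hh
  have hhi : IntegrableOn h (Ioi 0) := integrableOn_cpow_mul_exp_neg_mul hB hwc
  have hin : ∀ s : ℝ, ((c : ℂ) + s * I) ^ (-A) * (w - (c + s * I)) ^ (-B) * Gamma B =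
      ∫ t in Ioi (0 : ℝ), ((c : ℂ) + s * I) ^ (-A) * h t * exp (s * I * t) := by
    intro s
    have hre : 0 < (w - (c + s * I)).re := by simpa using hw
    rw [mul_assoc, ← integral_cpow_mul_exp_neg_mul_Ioi_of_re_pos hB hre, ← integral_const_mul]
    refine integral_congr_ae (ae_of_all _ fun t => ?_)
    simp only [hh]
    rw [mul_assoc, mul_assoc, ← Complex.exp_add]
    congr 3
    ring
  have hint : Integrable (Function.uncurry fun (s t : ℝ) =>
      ((c : ℂ) + s * I) ^ (-A) * h t * exp (s * I * t))
      (volume.prod (volume.restrict (Ioi 0))) := by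
    refine ((integrable_vertical_cpow hc hA).mul_prod hhi).mul_bdd (c := 1)
      (Continuous.aestronglyMeasurable (by fun_prop)) (ae_of_all _ fun z => ?_)
    rw [show (z.1 : ℂ) * I * z.2 = ((z.1 * z.2 : ℝ) : ℂ) * I by push_cast; ring,
      norm_exp_ofReal_mul_I]
  have hAB : 0 < (A + B - 1).re := by simp; linarith
  have hfin : (∫ s : ℝ, ((c : ℂ) + s * I) ^ (-A) * (w - (c + s * I)) ^ (-B)) * Gamma B =
      2 * Real.pi / Gamma A * (w ^ (-(A + B - 1)) * Gamma (A + B - 1)) := by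
    rw [← integral_mul_const]
    simp only [hin]
    rw [integral_integral_swap hint,
      ← integral_cpow_mul_exp_neg_mul_Ioi_of_re_pos hAB (hc.trans hw), ← integral_const_mul]
    refine setIntegral_congr_fun measurableSet_Ioi fun t ht => ?_
    have ht0 : (t : ℂ) ≠ 0 := ofReal_ne_zero.mpr (ne_of_gt ht)
    calc ∫ s : ℝ, ((c : ℂ) + s * I) ^ (-A) * h t * exp (s * I * t)
        = ∫ s : ℝ, h t * (((c : ℂ) + s * I) ^ (-A) * exp (s * I * t)) := by
          refine integral_congr_ae (ae_of_all _ fun s => ?_)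
          simp only
          ring
      _ = h t * (2 * Real.pi / Gamma A * ((t : ℂ) ^ (A - 1) * exp (-(c * t)))) := by
          rw [integral_const_mul, integral_vertical_cpow_mul_exp hc hA ht]
      _ = 2 * Real.pi / Gamma A * (((t : ℂ) ^ (B - 1) * (t : ℂ) ^ (A - 1)) *
            (exp (-((w - c) * t)) * exp (-(c * t)))) := by
          simp only [hh]
          ring
      _ = _ := by
          rw [← cpow_add _ _ ht0, ← Complex.exp_add]
          congr 3
          · ring
          · ring
  rw [eq_div_of_mul_eq hGB hfin]
  field_simp

end LineIntegral

/-! ### The double line integral and the transform `L_{x,y}`. -/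

section DoubleLine

/-- The integrand of the double line integral. -/
noncomputable def lineFun (A B M : ℂ) (s : ℝ × ℝ) : ℂ :=
  lineThird s.1 ^ (-A) * lineThird s.2 ^ (-B) * (1 - lineThird s.1 - lineThird s.2) ^ (-M)

theorem lineThird_eq (s : ℝ) : lineThird s = ((1 / 3 : ℝ) : ℂ) + s * I := by
  simp [lineThird]

theorem lineThird_re (s : ℝ) : (lineThird s).re = 1 / 3 := by
  simp [lineThird_eq]

theorem lineThird_ne_zero (s : ℝ) : lineThird s ≠ 0 :=
  ne_zero_of_re_pos (by rw [lineThird_re]; norm_num)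

theorem one_third_le_norm_lineThird (s : ℝ) : 1 / 3 ≤ ‖lineThird s‖ := by
  rw [← lineThird_re s]
  exact re_le_norm _

theorem continuous_lineThird : Continuous lineThird := by
  unfold lineThird
  fun_prop

theorem one_sub_lineThird_re (s t : ℝ) : (1 - lineThird s - lineThird t).re = 1 / 3 := by
  simp [lineThird_re]
  norm_num

theorem continuous_one_sub_lineThird_cpow (M : ℂ) :
    Continuous fun s : ℝ × ℝ => (1 - lineThird s.1 - lineThird s.2) ^ M :=
  ((continuous_const.sub (continuous_lineThird.comp continuous_fst)).sub
    (continuous_lineThird.comp continuous_snd)).cpow continuous_const fun s =>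
    mem_slitPlane_of_re_pos
      ((by norm_num : (0 : ℝ) < 1 / 3).trans_eq (one_sub_lineThird_re s.1 s.2).symm)

theorem integrable_lineThird_cpow {A : ℂ} (hA : 1 < A.re) :
    Integrable fun s => lineThird s ^ (-A) := by
  simp only [lineThird_eq]
  exact integrable_vertical_cpow (by norm_num) hA

/-- The first two factors are integrable separately, and the third is bounded because its base has
real part `1/3` on the contour. -/
theorem integrable_lineFun {A B M : ℂ} (hA : 1 < A.re) (hB : 1 < B.re) (hM : 0 < M.re) :
    Integrable (lineFun A B M) := by
  rw [Measure.volume_eq_prod]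
  refine ((integrable_lineThird_cpow hA).mul_prod (integrable_lineThird_cpow hB)).mul_bdd
    (c := (1 / 3 : ℝ) ^ (-M.re) * Real.exp (Real.pi * |(-M).im|))
    (continuous_one_sub_lineThird_cpow (-M)).aestronglyMeasurable (ae_of_all _ fun s => ?_)
  refine (norm_cpow_le_mul_exp _ _).trans ?_
  rw [neg_re]
  have h : 1 / 3 ≤ ‖1 - lineThird s.1 - lineThird s.2‖ := by
    rw [← one_sub_lineThird_re s.1 s.2]
    exact re_le_norm _
  have := Real.rpow_le_rpow_of_nonpos (z := -M.re) (by norm_num) h (by linarith)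
  gcongr

theorem integral_lineThird_cpow_mul_cpow {A B w : ℂ} (hA : 1 < A.re) (hB : 0 < B.re)
    (hw : 1 / 3 < w.re) :
    ∫ s : ℝ, lineThird s ^ (-A) * (w - lineThird s) ^ (-B) =
      2 * Real.pi * Gamma (A + B - 1) / (Gamma A * Gamma B) * w ^ (-(A + B - 1)) := by
  simp only [lineThird_eq]
  exact integral_vertical_cpow_mul_cpow (by norm_num) hA hB hw

/-- Two convolutions of powers in succession: the inner one at `w = 1 - lineThird s`, the outer one
at `w = 1`. -/
theorem integral_lineFun {A B M : ℂ} (hA : 1 < A.re) (hB : 1 < B.re) (hM : 0 < M.re) :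
    ∫ s, lineFun A B M s =
      (2 * Real.pi) ^ 2 * Gamma (A + B + M - 2) / (Gamma A * Gamma B * Gamma M) := by
  have hBM : 0 < (B + M - 1).re := by simp; linarith
  rw [Measure.volume_eq_prod, integral_prod _ (integrable_lineFun hA hB hM)]
  have hin : ∀ s : ℝ, ∫ t, lineFun A B M (s, t) =
      2 * Real.pi * Gamma (B + M - 1) / (Gamma B * Gamma M) *
        (lineThird s ^ (-A) * (1 - lineThird s) ^ (-(B + M - 1))) := by
    intro s
    simp only [lineFun, mul_assoc]
    rw [integral_const_mul, integral_lineThird_cpow_mul_cpow hB hM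
      (by simp [lineThird_re]; norm_num)]
    ring
  simp only [hin]
  rw [integral_const_mul, integral_lineThird_cpow_mul_cpow hA hBM (by norm_num),
    one_cpow, show A + (B + M - 1) - 1 = A + B + M - 2 by ring]
  have := Gamma_ne_zero_of_re_pos hBM
  field_simp

/-- The value of the normalized double line integral on a monomial. -/
theorem integral_lineFun_mul_pow {a b μ : ℂ} (hμ : -2 < μ.re) (ha : 1 < a.re) (hb : 1 < b.re)
    (m n : ℕ) :
    -(Gamma (μ + 2) * (Gamma a * Gamma b) / ((2 * Real.pi * I) ^ 2 * Gamma (a + b + μ))) *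
      ∫ s, lineFun a b (μ + 2) s * ((1 / (3 * lineThird s.1)) ^ m * (1 / (3 * lineThird s.2)) ^ n) =
    poch (a + b + μ) (m + n) / (poch a m * poch b n) * (1 / 3) ^ (m + n) := by
  have ha0 : 0 < a.re := by linarith
  have hb0 : 0 < b.re := by linarith
  have hc : 0 < (a + b + μ).re := by simp only [add_re]; linarith
  have hμ2 : 0 < (μ + 2).re := by simp; linarith
  have hpow : ∀ (s : ℝ) (z : ℂ) (k : ℕ), lineThird s ^ (-z) * (1 / (3 * lineThird s)) ^ k =
      (1 / 3) ^ k * lineThird s ^ (-(z + k)) := by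
    intro s z k
    rw [neg_add, cpow_add _ _ (lineThird_ne_zero s), cpow_neg _ (k : ℂ), cpow_natCast,
      ← one_div_mul_one_div, mul_pow, one_div (lineThird s), inv_pow]
    ring
  have h : ∀ s : ℝ × ℝ, lineFun a b (μ + 2) s *
      ((1 / (3 * lineThird s.1)) ^ m * (1 / (3 * lineThird s.2)) ^ n) =
      (1 / 3) ^ (m + n) * lineFun (a + m) (b + n) (μ + 2) s := by
    intro s
    calc _ = (lineThird s.1 ^ (-a) * (1 / (3 * lineThird s.1)) ^ m) *
          (lineThird s.2 ^ (-b) * (1 / (3 * lineThird s.2)) ^ n) *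
            (1 - lineThird s.1 - lineThird s.2) ^ (-(μ + 2)) := by
          simp only [lineFun]
          ring
      _ = _ := by
          rw [hpow, hpow, lineFun, pow_add]
          ring
  simp only [h]
  rw [integral_const_mul, integral_lineFun (by simp; linarith [m.cast_nonneg (α := ℝ)])
      (by simp; linarith [n.cast_nonneg (α := ℝ)]) hμ2,
    show a + m + (b + n) + (μ + 2) - 2 = a + b + μ + ((m + n : ℕ) : ℂ) by push_cast; ring,
    Gamma_add_nat_eq_poch (notMem_nonposInts_of_re_pos ha0),
    Gamma_add_nat_eq_poch (notMem_nonposInts_of_re_pos hb0),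
    Gamma_add_nat_eq_poch (notMem_nonposInts_of_re_pos hc), mul_pow, mul_pow, I_sq]
  have h1 := Gamma_ne_zero_of_re_pos hμ2
  have h2 := Gamma_ne_zero_of_re_pos ha0
  have h3 := Gamma_ne_zero_of_re_pos hb0
  have h4 := Gamma_ne_zero_of_re_pos hc
  have h5 := poch_ne_zero (notMem_nonposInts_of_re_pos ha0) m
  have h6 := poch_ne_zero (notMem_nonposInts_of_re_pos hb0) n
  have h7 : (Real.pi : ℂ) ≠ 0 := ofReal_ne_zero.mpr Real.pi_ne_zero
  field_simp

/-- The factors `dt_j / t_j` lower each exponent by one, and `I * I` from `dt_j = i ds_j` gives the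
sign. -/
theorem intLxy_integrand_eq (μ a b : ℂ) (v : ℂ) (s t : ℝ) :
    lineThird s ^ (1 - a) * lineThird t ^ (1 - b) *
        (1 - lineThird s - lineThird t) ^ (-μ - 2) * v * (I / lineThird s) * (I / lineThird t) =
      -(lineFun a b (μ + 2) (s, t) * v) := by
  have hs := lineThird_ne_zero s
  have ht := lineThird_ne_zero t
  rw [lineFun, sub_eq_add_neg 1 a, sub_eq_add_neg 1 b, cpow_add _ _ hs, cpow_add _ _ ht, cpow_one,
    cpow_one, show -μ - 2 = -(μ + 2) by ring]
  field_simp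
  rw [I_sq]
  ring

/-- On the contour `‖1 / t_j‖ ≤ 3`, so the weight `3 ^ (m + n)` is moved to the coefficients,
leaving monomials in `1 / (3 t_j)` of norm at most 1. -/
theorem hasSum_intLxy {a b μ : ℂ} (hμ : -2 < μ.re) (ha : 1 < a.re) (hb : 1 < b.re)
    {e : ℕ × ℕ → ℂ} {u : ℂ → ℂ → ℂ} {x y : ℂ} (he : Summable fun i => ‖e i‖ * 3 ^ (i.1 + i.2))
    (hu : ∀ s t : ℝ, HasSum (fun i => e i * ((1 / lineThird s) ^ i.1 * (1 / lineThird t) ^ i.2))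
      (u (x / lineThird s) (y / lineThird t))) :
    HasSum (fun i => e i * (poch (a + b + μ) (i.1 + i.2) / (poch a i.1 * poch b i.2)))
      (intLxy μ a b u x y) := by
  have hW := integrable_lineFun ha hb (M := μ + 2) (by simp; linarith)
  have he3 : Summable fun i : ℕ × ℕ => ‖e i * 3 ^ (i.1 + i.2)‖ := by simpa using he
  have hcont : ∀ i : ℕ × ℕ, Continuous fun s : ℝ × ℝ =>
      (1 / (3 * lineThird s.1)) ^ i.1 * (1 / (3 * lineThird s.2)) ^ i.2 := by
    intro i
    have h3 : ∀ k : ℕ, Continuous fun s : ℝ => (1 / (3 * lineThird s)) ^ k := fun k =>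
      (continuous_const.div (continuous_const.mul continuous_lineThird)
        fun s => mul_ne_zero three_ne_zero (lineThird_ne_zero s)).pow k
    exact ((h3 i.1).comp continuous_fst).mul ((h3 i.2).comp continuous_snd)
  have hle1 : ∀ (s : ℝ) (k : ℕ), ‖(1 / (3 * lineThird s)) ^ k‖ ≤ 1 := by
    intro s k
    rw [norm_pow]
    refine pow_le_one₀ (norm_nonneg _) ?_
    have := one_third_le_norm_lineThird s
    rw [norm_div, norm_one, norm_mul, Complex.norm_ofNat, div_le_one (by linarith)]
    linarith
  have hle : ∀ (i : ℕ × ℕ) (s : ℝ × ℝ),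
      ‖(1 / (3 * lineThird s.1)) ^ i.1 * (1 / (3 * lineThird s.2)) ^ i.2‖ ≤ 1 := by
    intro i s
    rw [norm_mul]
    exact mul_le_one₀ (hle1 _ _) (norm_nonneg _) (hle1 _ _)
  have hu' : ∀ s : ℝ × ℝ, HasSum (fun i : ℕ × ℕ => e i * 3 ^ (i.1 + i.2) *
      ((1 / (3 * lineThird s.1)) ^ i.1 * (1 / (3 * lineThird s.2)) ^ i.2))
      (u (x / lineThird s.1) (y / lineThird s.2)) := by
    intro s
    refine (hu s.1 s.2).of_forall_eq fun i => ?_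
    have hs := lineThird_ne_zero s.1
    have ht := lineThird_ne_zero s.2
    rw [← one_div_mul_one_div, ← one_div_mul_one_div, mul_pow, mul_pow, pow_add,
      one_div (3 : ℂ), inv_pow, inv_pow]
    field_simp
  have key := hasSum_integral_weight (u := fun s : ℝ × ℝ => u (x / lineThird s.1)
    (y / lineThird s.2)) hW he3 (fun i => (hcont i).aestronglyMeasurable)
    (fun i => ae_of_all _ (hle i)) (ae_of_all _ hu')
  have hint := integrable_weight_mul_of_hasSum (u := fun s : ℝ × ℝ => u (x / lineThird s.1)
    (y / lineThird s.2)) hW he3 (fun i => (hcont i).aestronglyMeasurable)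
    (fun i => ae_of_all _ (hle i)) (ae_of_all _ hu')
  have hval : intLxy μ a b u x y =
      -(Gamma (μ + 2) * (Gamma a * Gamma b) / ((2 * Real.pi * I) ^ 2 * Gamma (a + b + μ))) *
        ∫ s : ℝ × ℝ, lineFun a b (μ + 2) s * u (x / lineThird s.1) (y / lineThird s.2) := by
    rw [Measure.volume_eq_prod] at hint ⊢
    rw [intLxy, integral_prod _ hint]
    simp only [intLxy_integrand_eq, integral_neg]
    ring
  rw [hval]
  refine (key.mul_left _).of_forall_eq fun i => ?_
  have h := integral_lineFun_mul_pow hμ ha hb i.1 i.2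
  rw [mul_left_comm, h, one_div, inv_pow]
  field_simp

theorem hasSum_opLxy {a b μ : ℂ} (ha : a ∉ nonposInts) (hb : b ∉ nonposInts)
    {e : ℕ × ℕ → ℂ} {u : ℂ → ℂ → ℂ} {x y : ℂ} (he : Summable fun i => ‖e i‖ * 3 ^ (i.1 + i.2))
    (hu : ∀ s t : ℝ, HasSum (fun i => e i * ((1 / lineThird s) ^ i.1 * (1 / lineThird t) ^ i.2))
      (u (x / lineThird s) (y / lineThird t))) :
    HasSum (fun i => e i * (poch (a + b + μ) (i.1 + i.2) / (poch a i.1 * poch b i.2)))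
      (opLxy μ a b u x y) := by
  have hcont : Differentiable ℂ fun P : ℂ × ℂ × ℂ => P.2.1 + P.2.2 + P.1 := by fun_prop
  have hc1 : Continuous fun P : ℂ × ℂ × ℂ => P.2.1 := by fun_prop
  have hc2 : Continuous fun P : ℂ × ℂ × ℂ => P.2.2 := by fun_prop
  unfold opLxy
  refine hasSum_holoExt (V := {P : ℂ × ℂ × ℂ | -2 < P.1.re ∧ 1 < P.2.1.re ∧ 1 < P.2.2.re})
    (Ω := {P : ℂ × ℂ × ℂ | P.2.1 ∉ nonposInts ∧ P.2.2 ∉ nonposInts})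
    (f := fun P => intLxy P.1 P.2.1 P.2.2 u x y)
    (P := (μ, a, b)) (P₀ := ((0 : ℂ), (2 : ℂ), (2 : ℂ))) (b := fun i => 3 ^ (i.1 + i.2)) (e := e)
    (M := fun i P => poch (P.2.1 + P.2.2 + P.1) (i.1 + i.2) / (poch P.2.1 i.1 * poch P.2.2 i.2))
    ?_ ?_ he ?_ ?_ ?_ ?_ ?_ ⟨ha, hb⟩ ?_
  · exact (isOpen_lt continuous_const (continuous_re.comp continuous_fst)).inter
      ((isOpen_lt continuous_const (continuous_re.comp hc1)).inter
        (isOpen_lt continuous_const (continuous_re.comp hc2)))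
  · exact (isClosed_nonposInts.isOpen_compl.preimage hc1).inter
      (isClosed_nonposInts.isOpen_compl.preimage hc2)
  · intro i P hP
    have h1 := differentiable_poch_comp (f := fun P : ℂ × ℂ × ℂ => P.2.1) (by fun_prop) i.1
    have h2 := differentiable_poch_comp (f := fun P : ℂ × ℂ × ℂ => P.2.2) (by fun_prop) i.2
    have h3 := differentiable_poch_comp hcont (i.1 + i.2)
    have h4 : poch P.2.1 i.1 * poch P.2.2 i.2 ≠ 0 :=
      mul_ne_zero (poch_ne_zero hP.1 _) (poch_ne_zero hP.2 _)
    simp only [div_eq_mul_inv]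
    exact ((h3 P).fun_mul (((h1.fun_mul h2) P).fun_inv h4)).differentiableWithinAt
  · intro P hP
    -- With `K = 3 / 2` the rate `2 * K` is 3, the one already required for termwise integration, so
    -- the continuation costs no further radius.
    obtain ⟨C, hC⟩ := eventually_norm_poch_div_mul_le (l := 𝓝 P) (K := 3 / 2)
      (hc1.tendsto P) (hc2.tendsto P) (hcont.continuous.tendsto P) hP.1 hP.2 (by norm_num)
    refine ⟨C, hC.mono fun Q hQ i => (hQ i.1 i.2).trans_eq ?_⟩
    norm_num
  · intro P hP
    exact hasSum_intLxy hP.1 hP.2.1 hP.2.2 he hu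
  · simp
  · intro P hP
    exact ⟨notMem_nonposInts_of_re_pos (by linarith [hP.2.1]),
      notMem_nonposInts_of_re_pos (by linarith [hP.2.2])⟩
  · have h2 : (2 : ℂ) ∉ nonposInts := notMem_nonposInts_of_re_pos (by norm_num)
    refine ((countable_affine_mem_nonposInts (b := a - 2) h2).union
      (countable_affine_mem_nonposInts (b := b - 2) h2)).mono fun z hz => ?_
    simp only [mem_ofPred_eq, mem_union, not_and_or, not_not, Prod.snd_add, Prod.fst_add,
      Prod.smul_snd, Prod.smul_fst, Prod.snd_sub, Prod.fst_sub, smul_eq_mul] at hz ⊢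
    exact hz

end DoubleLine

/-! ### Transforms acting on double power series. -/

section DoubleSeries

/-- `u` is the sum of the (absolutely convergent) double power series with coefficients `c` on `D`. -/
def HasDoubleSeries (D : Set (ℂ × ℂ)) (c : ℕ × ℕ → ℂ) (u : ℂ → ℂ → ℂ) : Prop :=
  ∀ x y, (x, y) ∈ D → HasSum (fun i : ℕ × ℕ => c i * (x ^ i.1 * y ^ i.2)) (u x y)

/-- An open set in `ℂ × ℂ` that contains with a point the closed polydisc through it. -/
structure IsReinhardt (D : Set (ℂ × ℂ)) : Prop where
  isOpen : IsOpen D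
  smul_mem : ∀ {x y s t : ℂ}, (x, y) ∈ D → ‖s‖ ≤ 1 → ‖t‖ ≤ 1 → (s * x, t * y) ∈ D

/-- The slack `K > 1` absorbs the growth `K ^ (m + n)` of the multipliers, so the `K` transforms
lose nothing of the domain. -/
theorem IsReinhardt.exists_one_lt {D : Set (ℂ × ℂ)} (hD : IsReinhardt D) {x y : ℂ}
    (h : (x, y) ∈ D) : ∃ K : ℝ, 1 < K ∧ (K * x, K * y) ∈ D := by
  have hc : Continuous fun K : ℝ => ((K : ℂ) * x, (K : ℂ) * y) := by fun_prop
  have h1 : ∀ᶠ K : ℝ in 𝓝 1, ((K : ℂ) * x, (K : ℂ) * y) ∈ D :=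
    hc.continuousAt.eventually_mem (hD.isOpen.mem_nhds (by simpa using h))
  obtain ⟨K, hK, hK1⟩ := ((h1.filter_mono nhdsWithin_le_nhds).and
    (self_mem_nhdsWithin (s := Ioi (1 : ℝ)))).exists
  exact ⟨K, hK1, hK⟩

variable {D : Set (ℂ × ℂ)} {c : ℕ × ℕ → ℂ} {u : ℂ → ℂ → ℂ}

theorem HasDoubleSeries.summable_mul_pow (hu : HasDoubleSeries D c u) {x y : ℂ} {K : ℝ}
    (hK : 0 ≤ K) (h : (K * x, K * y) ∈ D) :
    Summable fun i : ℕ × ℕ => ‖c i * (x ^ i.1 * y ^ i.2)‖ * K ^ (i.1 + i.2) := by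
  refine (hu _ _ h).summable.norm.congr fun i => ?_
  simp only [norm_mul, norm_pow, mul_pow, norm_real, Real.norm_of_nonneg hK]
  ring

theorem HasDoubleSeries.summable_mul_pow_of_le (hu : HasDoubleSeries D c u) {x y : ℂ} {K : ℝ}
    (hK : 1 < K) (h : (K * x, K * y) ∈ D) {k : ℕ × ℕ → ℕ} (hk : ∀ i, k i ≤ i.1 + i.2) :
    Summable fun i : ℕ × ℕ => ‖c i * (x ^ i.1 * y ^ i.2)‖ * K ^ k i := by
  refine (hu.summable_mul_pow (by linarith) h).of_nonneg_of_le (fun i => by positivity) fun i => ?_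
  gcongr
  · exact hK.le
  · exact hk i

theorem norm_ofReal_le_one {t : ℝ} (h0 : 0 < t) (h1 : t ≤ 1) : ‖(t : ℂ)‖ ≤ 1 := by
  rwa [norm_real, Real.norm_of_nonneg h0.le]

theorem HasDoubleSeries.opKx (hD : IsReinhardt D) (hu : HasDoubleSeries D c u) {μ ν κ : ℂ}
    (hκ : ν + μ = κ) (h : κ ∉ nonposInts) :
    HasDoubleSeries D (fun i => c i * (poch ν i.1 / poch κ i.1)) (opKx μ ν u) := by
  subst hκ
  intro x y hxy
  obtain ⟨K, hK1, hK⟩ := hD.exists_one_lt hxy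
  refine (hasSum_eulerK h hK1 (hu.summable_mul_pow_of_le hK1 hK (k := Prod.fst) (by simp))
    fun t h0 h1 => ?_).of_forall_eq fun i => by ring
  have h2 := hD.smul_mem hxy (norm_ofReal_le_one h0 h1) (norm_one (α := ℂ)).le
  rw [one_mul] at h2
  exact (hu _ _ h2).of_forall_eq fun i => by ring

theorem HasDoubleSeries.opKy (hD : IsReinhardt D) (hu : HasDoubleSeries D c u) {μ ν κ : ℂ}
    (hκ : ν + μ = κ) (h : κ ∉ nonposInts) :
    HasDoubleSeries D (fun i => c i * (poch ν i.2 / poch κ i.2)) (opKy μ ν u) := by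
  subst hκ
  intro x y hxy
  obtain ⟨K, hK1, hK⟩ := hD.exists_one_lt hxy
  refine (hasSum_eulerK h hK1 (hu.summable_mul_pow_of_le hK1 hK (k := Prod.snd) (by simp))
    fun t h0 h1 => ?_).of_forall_eq fun i => by ring
  have h2 := hD.smul_mem hxy (norm_one (α := ℂ)).le (norm_ofReal_le_one h0 h1)
  rw [one_mul] at h2
  exact (hu _ _ h2).of_forall_eq fun i => by ring

theorem HasDoubleSeries.opKtilde (hD : IsReinhardt D) (hu : HasDoubleSeries D c u) {μ ν κ : ℂ}
    (hκ : ν + μ = κ) (h : κ ∉ nonposInts) :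
    HasDoubleSeries D (fun i => c i * (poch ν (i.1 + i.2) / poch κ (i.1 + i.2)))
      (opKtilde μ ν u) := by
  subst hκ
  intro x y hxy
  obtain ⟨K, hK1, hK⟩ := hD.exists_one_lt hxy
  refine (hasSum_eulerK (k := fun i : ℕ × ℕ => i.1 + i.2) h hK1
    (hu.summable_mul_pow (by linarith) hK)
    fun t h0 h1 => ?_).of_forall_eq fun i => by ring
  have h2 := hD.smul_mem hxy (norm_ofReal_le_one h0 h1) (norm_ofReal_le_one h0 h1)
  exact (hu _ _ h2).of_forall_eq fun i => by ring

theorem HasDoubleSeries.opKxy (hD : IsReinhardt D) (hu : HasDoubleSeries D c u) {μ a b κ : ℂ}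
    (hκ : a + b + μ = κ) (h : κ ∉ nonposInts) :
    HasDoubleSeries D (fun i => c i * (poch a i.1 * poch b i.2 / poch κ (i.1 + i.2)))
      (opKxy μ a b u) := by
  subst hκ
  intro x y hxy
  obtain ⟨K, hK1, hK⟩ := hD.exists_one_lt hxy
  refine (hasSum_opKxy h hK1 (hu.summable_mul_pow (by linarith) hK)
    fun t ht => ?_).of_forall_eq fun i => by ring
  have h2 := hD.smul_mem hxy (norm_ofReal_le_one ht.1 (by linarith [ht.2.1, ht.2.2]))
    (norm_ofReal_le_one ht.2.1 (by linarith [ht.1, ht.2.2]))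
  exact (hu _ _ h2).of_forall_eq fun i => by ring

/-- The open ball of radius `1 / ρ` in the `ℓ¹`-norm. -/
def ballOne (ρ : ℝ) : Set (ℂ × ℂ) := {z | ρ * (‖z.1‖ + ‖z.2‖) < 1}

/-- The open unit bidisc. -/
def unitBidisc : Set (ℂ × ℂ) := {z | ‖z.1‖ < 1 ∧ ‖z.2‖ < 1}

theorem norm_mul_le_of_norm_le_one {s x : ℂ} (hs : ‖s‖ ≤ 1) : ‖s * x‖ ≤ ‖x‖ := by
  rw [norm_mul]
  exact mul_le_of_le_one_left (norm_nonneg x) hs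

theorem isReinhardt_unitBidisc : IsReinhardt unitBidisc where
  isOpen := (isOpen_lt continuous_fst.norm continuous_const).inter
    (isOpen_lt continuous_snd.norm continuous_const)
  smul_mem h hs ht :=
    ⟨(norm_mul_le_of_norm_le_one hs).trans_lt h.1, (norm_mul_le_of_norm_le_one ht).trans_lt h.2⟩

theorem isReinhardt_ballOne {ρ : ℝ} (hρ : 0 ≤ ρ) : IsReinhardt (ballOne ρ) where
  isOpen := isOpen_lt (by fun_prop) continuous_const
  smul_mem h hs ht := (mul_le_mul_of_nonneg_left (add_le_add (norm_mul_le_of_norm_le_one hs)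
    (norm_mul_le_of_norm_le_one ht)) hρ).trans_lt h

/-- The arguments `x / t` are contractions of `3 * x` by `1 / (3 t)`, so the old series must
converge at `(3 * x, 3 * y)`. -/
theorem HasDoubleSeries.opLxy {ρ : ℝ} (hρ : 0 ≤ ρ) (hu : HasDoubleSeries (ballOne ρ) c u)
    {μ a b κ : ℂ} (hκ : a + b + μ = κ) (ha : a ∉ nonposInts) (hb : b ∉ nonposInts) :
    HasDoubleSeries (ballOne (3 * ρ))
      (fun i => c i * (poch κ (i.1 + i.2) / (poch a i.1 * poch b i.2))) (opLxy μ a b u) := by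
  subst hκ
  intro x y hxy
  have h3 : (((3 : ℝ) : ℂ) * x, ((3 : ℝ) : ℂ) * y) ∈ ballOne ρ := by
    have h : 3 * ρ * (‖x‖ + ‖y‖) < 1 := hxy
    change ρ * (‖((3 : ℝ) : ℂ) * x‖ + ‖((3 : ℝ) : ℂ) * y‖) < 1
    rw [norm_mul, norm_mul, norm_real, Real.norm_of_nonneg (by norm_num)]
    linarith
  refine (hasSum_opLxy ha hb (hu.summable_mul_pow (by norm_num) h3)
    fun s t => ?_).of_forall_eq fun i => by ring
  have hle : ∀ s : ℝ, ‖1 / (3 * lineThird s)‖ ≤ 1 := by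
    intro s
    have := one_third_le_norm_lineThird s
    rw [norm_div, norm_one, norm_mul, Complex.norm_ofNat, div_le_one (by linarith)]
    linarith
  have h2 := (isReinhardt_ballOne hρ).smul_mem h3 (hle s) (hle t)
  have he : ∀ (s : ℝ) (x : ℂ), 1 / (3 * lineThird s) * (((3 : ℝ) : ℂ) * x) = x / lineThird s := by
    intro s x
    have := lineThird_ne_zero s
    push_cast
    field_simp
  rw [he, he] at h2
  refine (hu _ _ h2).of_forall_eq fun i => ?_
  simp only [div_pow, one_pow]
  ring

/-- Composition of operators that act on the coefficients of double power series. -/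
theorem HasDoubleSeries.opProd {T : ℕ → (ℂ → ℂ → ℂ) → (ℂ → ℂ → ℂ)} {M : ℕ → ℕ × ℕ → ℂ}
    {D : ℕ → Set (ℂ × ℂ)} {N : ℕ}
    (hT : ∀ k ∈ Finset.Icc 1 N, ∀ j c u, HasDoubleSeries (D j) c u →
      HasDoubleSeries (D (j + 1)) (fun i => c i * M k i) (T k u)) {j : ℕ}
    (hu : HasDoubleSeries (D j) c u) :
    HasDoubleSeries (D (j + N)) (fun i => c i * ∏ k ∈ Finset.Icc 1 N, M k i) (opProd T N u) := by
  induction N generalizing j c u with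
  | zero => simpa [_root_.opProd] using hu
  | succ N ih =>
    -- The last factor `T (N + 1)` acts first, so the induction hypothesis is applied from `j + 1`;
    -- hence `j` is generalized.
    have h := ih (fun k hk => hT k (Finset.Icc_subset_Icc_right N.le_succ hk))
      (hT (N + 1) (by simp) j c u hu)
    rw [add_right_comm, add_assoc] at h
    have heq : (fun i => c i * ∏ k ∈ Finset.Icc 1 (N + 1), M k i) =
        fun i => c i * M (N + 1) i * ∏ k ∈ Finset.Icc 1 N, M k i := by
      funext i
      rw [Finset.prod_Icc_succ_top (by omega)]
      ring
    rw [heq]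
    exact h

end DoubleSeries

/-! ### Binomial expansions of the starting functions. -/

section BaseSeries

theorem ringChoose_neg_eq (a : ℂ) (n : ℕ) :
    Ring.choose (-a) n = (-1) ^ n * (poch a n / n.factorial) := by
  have h := ascPochhammer_eval_neg_eq_descPochhammer ℂ (-a) n
  rw [neg_neg, descPochhammer_eval_eq_ascPochhammer] at h
  rw [poch, h, Ring.choose_eq_smul, Polynomial.descPochhammer_smeval_eq_ascPochhammer,
    Polynomial.ascPochhammer_smeval_cast, Polynomial.ascPochhammer_smeval_eq_eval, smul_eq_mul,
    ← mul_div_assoc, ← mul_assoc, ← mul_pow]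
  simp
  ring

/-- The binomial series. -/
theorem hasSum_one_sub_cpow (a : ℂ) {x : ℂ} (hx : ‖x‖ < 1) :
    HasSum (fun n : ℕ => poch a n / n.factorial * x ^ n) ((1 - x) ^ (-a)) := by
  have h := (one_add_cpow_hasFPowerSeriesOnBall_zero (a := -a)).hasSum (y := -x)
    (by simpa [← ofReal_norm] using hx)
  rw [zero_add, ← sub_eq_add_neg] at h
  refine h.of_forall_eq fun n => ?_
  rw [binomialSeries_apply, ringChoose_neg_eq]
  simp only [List.ofFn_const, List.prod_replicate, smul_eq_mul]
  have h1 : (-1 : ℂ) ^ n * (-1) ^ n = 1 := by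
    rw [← mul_pow]
    simp
  rw [neg_pow x n]
  linear_combination (-(poch a n / n.factorial * x ^ n)) * h1

theorem hasDoubleSeries_one_sub_cpow_mul (a b : ℂ) :
    HasDoubleSeries unitBidisc
      (fun i => poch a i.1 / i.1.factorial * (poch b i.2 / i.2.factorial))
      (fun x y => (1 - x) ^ (-a) * (1 - y) ^ (-b)) := by
  intro x y h
  have hx := hasSum_one_sub_cpow a h.1
  have hy := hasSum_one_sub_cpow b h.2
  have hxy := summable_mul_of_summable_norm hx.summable.norm hy.summable.norm
  refine HasSum.of_forall_eq (hx.mul hy hxy) fun i => ?_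
  ring

/-- Expansion of a power series in `x + y` into a double power series. -/
theorem hasSum_double_of_hasSum_add {d : ℕ → ℂ} {x y s : ℂ}
    (hd : Summable fun n => ‖d n‖ * (‖x‖ + ‖y‖) ^ n) (hs : HasSum (fun n => d n * (x + y) ^ n) s) :
    HasSum (fun i : ℕ × ℕ => d (i.1 + i.2) * (i.1 + i.2).choose i.1 * (x ^ i.1 * y ^ i.2)) s := by
  set f : ℕ × ℕ → ℂ :=
    fun i => d (i.1 + i.2) * (i.1 + i.2).choose i.1 * (x ^ i.1 * y ^ i.2) with hf
  have hsum : ∀ n : ℕ, ∑ i ∈ Finset.HasAntidiagonal.antidiagonal n, f i = d n * (x + y) ^ n := by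
    intro n
    rw [(Commute.all x y).add_pow', Finset.mul_sum]
    refine Finset.sum_congr rfl fun i hi => ?_
    rw [Finset.HasAntidiagonal.mem_antidiagonal] at hi
    rw [hf, ← hi, nsmul_eq_mul]
    ring
  have hnorm : ∀ n : ℕ, ∑ i ∈ Finset.HasAntidiagonal.antidiagonal n, ‖f i‖ =
      ‖d n‖ * (‖x‖ + ‖y‖) ^ n := by
    intro n
    rw [(Commute.all ‖x‖ ‖y‖).add_pow', Finset.mul_sum]
    refine Finset.sum_congr rfl fun i hi => ?_
    rw [Finset.HasAntidiagonal.mem_antidiagonal] at hi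
    simp only [hf, ← hi, nsmul_eq_mul, norm_mul, norm_pow, norm_natCast]
    ring
  let σ := Finset.HasAntidiagonal.sigmaAntidiagonalEquivProd (A := ℕ)
  have hfs : Summable f := by
    refine Summable.of_norm (σ.summable_iff.mp ?_)
    refine (summable_sigma_of_nonneg fun _ => norm_nonneg _).mpr
      ⟨fun n => (hasSum_fintype _).summable, hd.congr fun n => ?_⟩
    rw [tsum_fintype, ← hnorm n]
    exact (Finset.sum_coe_sort (Finset.HasAntidiagonal.antidiagonal n) fun i => ‖f i‖).symm
  have hσ : HasSum (f ∘ σ) (∑' i, f i) := σ.hasSum_iff.mpr hfs.hasSum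
  have hg : HasSum (fun n => d n * (x + y) ^ n) (∑' i, f i) := by
    refine hσ.sigma fun n => ?_
    rw [← hsum n, ← Finset.sum_coe_sort]
    exact hasSum_fintype _
  rw [hs.unique hg]
  exact hfs.hasSum

theorem hasDoubleSeries_one_sub_sub_cpow (a : ℂ) :
    HasDoubleSeries (ballOne 1)
      (fun i => poch a (i.1 + i.2) / (i.1.factorial * i.2.factorial))
      (fun x y => (1 - x - y) ^ (-a)) := by
  intro x y h
  have h1 : ‖x‖ + ‖y‖ < 1 := by simpa [ballOne] using h
  have hadd := hasSum_one_sub_cpow a ((norm_add_le x y).trans_lt h1)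
  have hn : ‖((‖x‖ + ‖y‖ : ℝ) : ℂ)‖ = ‖x‖ + ‖y‖ := by
    rw [norm_real, Real.norm_of_nonneg (by positivity)]
  have habs := (hasSum_one_sub_cpow a (hn.trans_lt h1)).summable.norm
  simp only [norm_mul, norm_pow, hn] at habs
  rw [← sub_sub] at hadd
  have key := hasSum_double_of_hasSum_add (d := fun n => poch a n / n.factorial)
    (by simpa only [norm_mul] using habs) hadd
  refine key.of_forall_eq fun i => ?_
  have h2 : ((i.1 + i.2).factorial : ℂ) =
      (i.1 + i.2).choose i.1 * i.1.factorial * i.2.factorial := by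
    rw [← Nat.add_choose_mul_factorial_mul_factorial i.1 i.2, Nat.choose_symm_add]
    push_cast
    ring
  have h3 : ((i.1 + i.2).choose i.1 : ℂ) ≠ 0 :=
    Nat.cast_ne_zero.mpr (Nat.choose_pos (Nat.le_add_right _ _)).ne'
  have h4 : (i.1.factorial : ℂ) ≠ 0 := Nat.cast_ne_zero.mpr i.1.factorial_ne_zero
  have h5 : (i.2.factorial : ℂ) ≠ 0 := Nat.cast_ne_zero.mpr i.2.factorial_ne_zero
  simp only [h2]
  field_simp

end BaseSeries

section Main

theorem prod_Icc_add {f : ℕ → ℂ} (s d : ℕ) :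
    ∏ i ∈ Finset.Icc 1 (s + d), f i =
      (∏ i ∈ Finset.Icc 1 s, f i) * ∏ k ∈ Finset.Icc 1 d, f (s + k) := by
  induction d with
  | zero => simp
  | succ d ih =>
    rw [← add_assoc, Finset.prod_Icc_succ_top (by omega), ih, Finset.prod_Icc_succ_top (by omega),
      mul_assoc, add_assoc]

theorem vecPoch_add (s d : ℕ) (a : ℕ → ℂ) (m : ℕ) :
    vecPoch (s + d) a m = vecPoch s a m * vecPoch d (fun k => a (s + k)) m :=
  prod_Icc_add s d

theorem vecPoch_succ (s : ℕ) (a : ℕ → ℂ) (m : ℕ) :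
    vecPoch (s + 1) a m = vecPoch s a m * poch (a (s + 1)) m :=
  Finset.prod_Icc_succ_top (by omega) _

/-- If `u` is the sum of the double series with the hypergeometric coefficients, it is `hypF`. -/
theorem summable_and_hypF_eq {D : Set (ℂ × ℂ)} {c : ℕ × ℕ → ℂ} {u : ℂ → ℂ → ℂ}
    (hu : HasDoubleSeries D c u) {p q r p' q' r' : ℕ} {α β γ α' β' γ' : ℕ → ℂ}
    (hc : ∀ m n, c (m, n) = (vecPoch p α m * vecPoch q β n * vecPoch r γ (m + n)) /
      (vecPoch p' (fun i => 1 - α' i) m * vecPoch q' (fun j => 1 - β' j) n *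
        vecPoch r' (fun k => 1 - γ' k) (m + n))) {x y : ℂ} (hxy : (x, y) ∈ D) :
    Summable (fun mn : ℕ × ℕ => hypTerm p q r p' q' r' α β γ α' β' γ' x y mn.1 mn.2) ∧
      hypF p q r p' q' r' α β γ α' β' γ' x y = u x y := by
  have h : HasSum (fun mn : ℕ × ℕ =>
      hypTerm p q r p' q' r' α β γ α' β' γ' x y mn.1 mn.2) (u x y) := by
    refine (hu x y hxy).of_forall_eq fun i => ?_
    rw [hypTerm, ← hc i.1 i.2, mul_assoc]
  exact ⟨h.summable, by rw [hypF, ← h.tsum_eq, h.summable.tsum_prod]⟩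

theorem HasDoubleSeries.opProd_const {T : ℕ → (ℂ → ℂ → ℂ) → (ℂ → ℂ → ℂ)} {M : ℕ → ℕ × ℕ → ℂ}
    {D : Set (ℂ × ℂ)} {N : ℕ}
    (hT : ∀ k ∈ Finset.Icc 1 N, ∀ c u, HasDoubleSeries D c u →
      HasDoubleSeries D (fun i => c i * M k i) (T k u)) {c : ℕ × ℕ → ℂ} {u : ℂ → ℂ → ℂ}
    (hu : HasDoubleSeries D c u) :
    HasDoubleSeries D (fun i => c i * ∏ k ∈ Finset.Icc 1 N, M k i) (_root_.opProd T N u) :=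
  HasDoubleSeries.opProd (D := fun _ => D) (j := 0) (fun k hk _ c u h => hT k hk c u h) hu

variable {D : Set (ℂ × ℂ)} {c : ℕ × ℕ → ℂ} {u : ℂ → ℂ → ℂ} {N : ℕ} {a a' : ℕ → ℂ}

theorem HasDoubleSeries.opProd_opKx (hD : IsReinhardt D)
    (ha' : ∀ i ∈ Finset.Icc 1 N, 1 - a' i ∉ nonposInts) (hu : HasDoubleSeries D c u) :
    HasDoubleSeries D (fun i => c i * (vecPoch N a i.1 / vecPoch N (fun k => 1 - a' k) i.1))
      (_root_.opProd (fun i => _root_.opKx (1 - a' i - a i) (a i)) N u) := by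
  have h := hu.opProd_const (N := N) (T := fun i => _root_.opKx (1 - a' i - a i) (a i))
    (M := fun k i => poch (a k) i.1 / poch (1 - a' k) i.1)
    fun k hk c u h => h.opKx hD (by ring) (ha' k hk)
  simp only [Finset.prod_div_distrib] at h
  exact h

theorem HasDoubleSeries.opProd_opKy (hD : IsReinhardt D)
    (ha' : ∀ i ∈ Finset.Icc 1 N, 1 - a' i ∉ nonposInts) (hu : HasDoubleSeries D c u) :
    HasDoubleSeries D (fun i => c i * (vecPoch N a i.2 / vecPoch N (fun k => 1 - a' k) i.2))
      (_root_.opProd (fun i => _root_.opKy (1 - a' i - a i) (a i)) N u) := by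
  have h := hu.opProd_const (N := N) (T := fun i => _root_.opKy (1 - a' i - a i) (a i))
    (M := fun k i => poch (a k) i.2 / poch (1 - a' k) i.2)
    fun k hk c u h => h.opKy hD (by ring) (ha' k hk)
  simp only [Finset.prod_div_distrib] at h
  exact h

theorem HasDoubleSeries.opProd_opKtilde (hD : IsReinhardt D)
    (ha' : ∀ i ∈ Finset.Icc 1 N, 1 - a' i ∉ nonposInts) (hu : HasDoubleSeries D c u) :
    HasDoubleSeries D
      (fun i => c i * (vecPoch N a (i.1 + i.2) / vecPoch N (fun k => 1 - a' k) (i.1 + i.2)))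
      (_root_.opProd (fun i => _root_.opKtilde (1 - a' i - a i) (a i)) N u) := by
  have h := hu.opProd_const (N := N) (T := fun i => _root_.opKtilde (1 - a' i - a i) (a i))
    (M := fun k i => poch (a k) (i.1 + i.2) / poch (1 - a' k) (i.1 + i.2))
    fun k hk c u h => h.opKtilde hD (by ring) (ha' k hk)
  simp only [Finset.prod_div_distrib] at h
  exact h

end Main

end HypergeometricTransforms

theorem mainTheorem11 (p q r p' q' r' : ℕ) (α β γ α' β' γ' : ℕ → ℂ)
    (hF₁ : p + r = p' + r') (hF₂ : q + r = q' + r')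
    (hp' : 1 ≤ p') (hq' : 1 ≤ q')
    (hα'0 : α' p' = 0) (hβ'0 : β' q' = 0)
    (hα' : ∀ i ∈ Finset.Icc 1 p', 1 - α' i ∉ nonposInts)
    (hβ' : ∀ j ∈ Finset.Icc 1 q', 1 - β' j ∉ nonposInts)
    (hγ' : ∀ k ∈ Finset.Icc 1 r', 1 - γ' k ∉ nonposInts) :
    (r ≤ r' → ∀ x y : ℂ, ‖x‖ < 1 → ‖y‖ < 1 →
      Summable (fun mn : ℕ × ℕ =>
        hypTerm p q r p' q' r' α β γ α' β' γ' x y mn.1 mn.2) ∧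
      hypF p q r p' q' r' α β γ α' β' γ' x y =
        (opProd (fun i => opKx (1 - α' i - α i) (α i)) (p' - 1) <|
         opProd (fun j => opKy (1 - β' j - β j) (β j)) (q' - 1) <|
         opProd (fun k => opKtilde (1 - γ' k - γ k) (γ k)) r <|
         opProd (fun k => opKxy (1 - γ' (r + k) - α (p' + k - 1) - β (q' + k - 1))
           (α (p' + k - 1)) (β (q' + k - 1))) (r' - r) <|
         fun x y => (1 - x) ^ (-α p) * (1 - y) ^ (-β q)) x y) ∧
    (r' < r → ∀ x y : ℂ, 3 ^ (r - r' - 1) * (‖x‖ + ‖y‖) < 1 →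
      Summable (fun mn : ℕ × ℕ =>
        hypTerm p q r p' q' r' α β γ α' β' γ' x y mn.1 mn.2) ∧
      hypF p q r p' q' r' α β γ α' β' γ' x y =
        (opProd (fun i => opKx (1 - α' i - α i) (α i)) p <|
         opProd (fun j => opKy (1 - β' j - β j) (β j)) q <|
         opProd (fun k => opKtilde (1 - γ' k - γ k) (γ k)) r' <|
         opProd (fun k => opLxy (γ (r' + k) - (1 - α' (p + k)) - (1 - β' (q + k)))
           (1 - α' (p + k)) (1 - β' (q + k))) (r - r' - 1) <|
         fun x y => (1 - x - y) ^ (-γ r)) x y) := by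
  obtain ⟨s, rfl⟩ : ∃ s, p' = s + 1 := ⟨p' - 1, by omega⟩
  obtain ⟨t, rfl⟩ : ∃ t, q' = t + 1 := ⟨q' - 1, by omega⟩
  constructor
  · intro hr x y hx hy
    obtain ⟨d, rfl⟩ : ∃ d, r' = r + d := ⟨r' - r, by omega⟩
    obtain rfl : p = s + d + 1 := by omega
    obtain rfl : q = t + d + 1 := by omega
    have h0 := hasDoubleSeries_one_sub_cpow_mul (α (s + d + 1)) (β (t + d + 1))
    have h1 := h0.opProd_const (N := d)
      (T := fun k => opKxy (1 - γ' (r + k) - α (s + k) - β (t + k)) (α (s + k)) (β (t + k)))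
      (M := fun k i => poch (α (s + k)) i.1 * poch (β (t + k)) i.2 /
        poch (1 - γ' (r + k)) (i.1 + i.2))
      fun k hk c u h => h.opKxy isReinhardt_unitBidisc (by ring)
        (hγ' _ (by simp at hk ⊢; omega))
    have h2 := h1.opProd_opKtilde (N := r) (a := γ) (a' := γ') isReinhardt_unitBidisc
      fun k hk => hγ' k (by simp at hk ⊢; omega)
    have h3 := h2.opProd_opKy (N := t) (a := β) (a' := β') isReinhardt_unitBidisc
      fun k hk => hβ' k (by simp at hk ⊢; omega)
    have h4 := h3.opProd_opKx (N := s) (a := α) (a' := α') isReinhardt_unitBidisc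
      fun k hk => hα' k (by simp at hk ⊢; omega)
    have e1 : ∀ (s k : ℕ), s + 1 + k - 1 = s + k := fun s k => by omega
    simp only [Nat.add_sub_cancel, Nat.add_sub_cancel_left, e1]
    refine summable_and_hypF_eq h4 (fun m n => ?_) (show (x, y) ∈ unitBidisc from ⟨hx, hy⟩)
    simp only [vecPoch_succ, vecPoch_add, hα'0, hβ'0, sub_zero, ascPochhammer_eval_one,
      Finset.prod_div_distrib, Finset.prod_mul_distrib]
    simp only [vecPoch, div_eq_mul_inv, mul_inv]
    ring
  · intro hr x y hxy
    obtain ⟨d, rfl⟩ : ∃ d, r = r' + d + 1 := ⟨r - r' - 1, by omega⟩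
    obtain rfl : s = p + d := by omega
    obtain rfl : t = q + d := by omega
    have e1 : r' + d + 1 - r' - 1 = d := by omega
    rw [e1] at hxy
    have hD : IsReinhardt (ballOne (3 ^ d)) := isReinhardt_ballOne (by positivity)
    have h0 := hasDoubleSeries_one_sub_sub_cpow (γ (r' + d + 1))
    have h1 := HasDoubleSeries.opProd (D := fun j => ballOne (3 ^ j)) (j := 0) (N := d)
      (T := fun k => opLxy (γ (r' + k) - (1 - α' (p + k)) - (1 - β' (q + k)))
           (1 - α' (p + k)) (1 - β' (q + k)))
      (M := fun k i => poch (γ (r' + k)) (i.1 + i.2) /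
        (poch (1 - α' (p + k)) i.1 * poch (1 - β' (q + k)) i.2))
      (fun k hk j c u h => by
        rw [pow_succ']
        exact h.opLxy (by positivity) (by ring) (hα' _ (by simp at hk ⊢; omega))
          (hβ' _ (by simp at hk ⊢; omega)))
      (by simpa using h0)
    rw [zero_add] at h1
    have h2 := h1.opProd_opKtilde (N := r') (a := γ) (a' := γ') hD hγ'
    have h3 := h2.opProd_opKy (N := q) (a := β) (a' := β') hD
      fun k hk => hβ' k (by simp at hk ⊢; omega)
    have h4 := h3.opProd_opKx (N := p) (a := α) (a' := α') hD
      fun k hk => hα' k (by simp at hk ⊢; omega)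
    rw [e1]
    refine summable_and_hypF_eq h4 (fun m n => ?_) hxy
    simp only [vecPoch_succ, vecPoch_add, hα'0, hβ'0, sub_zero, ascPochhammer_eval_one,
      Finset.prod_div_distrib, Finset.prod_mul_distrib]
    simp only [vecPoch, div_eq_mul_inv, mul_inv]
    ring
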